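/- **Theorem 3 (linear generalization).** *Linear cascading bandit.* Let $1\le K\le L$ and $d$ be integers, let $x(1),\dots,x(L)\in\mathbb{R}^d$ be feature vectors known to the agent and $\beta\in\mathbb{R}^d$ an unknown vector with $w(i):=x(i)^\top\beta\in[0,1]$ for all $i\in[L]$. At each time step $t=1,2,\dots$ the agent shows an ordered list $S_t=(i^t_1,\dots,i^t_K)$ of $K$ distinct items. Independently of everything that happened before and of $S_t$, independent variables $W_t(i)\sim\mathrm{Bern}(w(i))$, $i\in[L]$, are drawn. The agent is told the click position $k_t=\min\{k\le K: W_t(i^t_k)=1\}$ ($k_t=\infty$ if there is no such $k$), and so observes exactly $W_t(i^t_k)$ for $k\le \min\{k_t,K\}$. The expected reward of a list is $r(S|w)=1-\prod_{i\in S}(1-w(i))$, $S^*$ is a list maximizing it, and the expected regret is $\mathrm{Reg}(T)=\mathbb{E}\big[\sum_{t=1}^T\big(r(S^*|w)-r(S_t|w)\big)\big]$. *Algorithm LinTS-Cascade($\lambda$).* Put $M_1=I_{d}$ and $b_1=0$. At time $t$ put $\hat\psi_t=M_t^{-1}b_t$ and $v_t=3\sqrt{d\log t}$, draw $\xi_t\sim\mathcal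 N(0,I_d)$ independently of the past and put $\rho_t=\hat\psi_t+\lambda v_t\sqrt{K}\,M_t^{-1/2}\xi_t$. For $k=1,\dots,K$ choose $i^t_k\in\operatorname{argmax}_{i\in[L]\setminus\{i^t_1,\dots,i^t_{k-1}\}}x(i)^\top\rho_t$ (ties are broken in any way that does not use the variables $W_s(i)$, $s\ge t$), and show $S_t=(i^t_1,\dots,i^t_K)$. Finally let $M_{t+1}=M_t+\sum_i x(i)x(i)^\top$ and $b_{t+1}=b_t+\sum_i W_t(i)\,x(i)$, both sums over the items observed at time $t$. *Claim.* For every $\lambda>0$ and every $B$ there is a constant $C$, depending only on $\lambda$ and $B$, such that for all $d$, all $1\le K\le L$, all feature vectors with $\|x(i)\|_2\le 1/\sqrt K$ for all $i\in[L]$, all $\beta$ with $\|\beta\|_2\le B$ and $x(i)^\top\beta\in[0,1]$ for all $i\in[L]$, and all $T\ge 2$, LinTS-Cascade($\lambda$) satisfies $$\mathrm{Reg}(T)\;\le\; C\cdot\min\{\sqrt d,\sqrt{\log L}\}\cdot K\,d\,\sqrt T\,(\log T)^{3/2}.$$ In particular, under the normalization $\|\beta\|_2\le 1$ the constant depends only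 on $\lambda$. -/

import Mathlib

open MeasureTheory ProbabilityTheory

namespace CascadingBandit

noncomputable section

variable {d L K : ℕ}

/-- Click probabilities of the linear model: `w(i) = x(i)ᵀ β`. -/
def weight (x : Fin L → EuclideanSpace ℝ (Fin d)) (β : EuclideanSpace ℝ (Fin d)) (i : Fin L) : ℝ :=
  inner ℝ (x i) β

/-- A recommendation list: an ordered list of `K` distinct items out of `L` (a `K`-permutation). -/
abbrev RecList (K L : ℕ) : Type := Fin K ↪ Fin L

/-- Expected instantaneous reward `r(S | w) = 1 - ∏_{k} (1 - w(i_k))` of the list `S`. -/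
def reward (w : Fin L → ℝ) (S : RecList K L) : ℝ := 1 - ∏ k, (1 - w (S k))

/-- Expected instantaneous reward of an optimal list: the maximum of `r(S | w)` over the
(finitely many) lists `S`. -/
def optReward (K : ℕ) (w : Fin L → ℝ) : ℝ := ⨆ S : RecList K L, reward w S

/-- Feedback for the list `S` when the items that would attract the user are those `i` with
`W i = true`: the position of the first attractive item, and `⊤` if there is none. -/
def clickPos (S : RecList K L) (W : Fin L → Bool) : WithTop (Fin K) :=
  (Finset.univ.filter fun k => W (S k) = true).min

/-- The observed positions of the list: those up to and including the click, and all of them if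
there is no click. -/
def observed (S : RecList K L) (W : Fin L → Bool) : Finset (Fin K) :=
  Finset.univ.filter fun k => (k : WithTop (Fin K)) ≤ clickPos S W

/-! Rounds are numbered from `0`: round `n` is the time step `t = n + 1`. In the next four
definitions `S` and `W` are the realized sequences of lists and of attractions. -/

/-- The matrix `M_t` at the start of round `n` (`t = n + 1`); `M_1` is the identity matrix. -/
def gram (x : Fin L → EuclideanSpace ℝ (Fin d)) (S : ℕ → RecList K L) (W : ℕ → Fin L → Bool) :
    ℕ → Matrix (Fin d) (Fin d) ℝ
  | 0 => 1
  | n + 1 => gram x S W n +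
      ∑ k ∈ observed (S n) (W n), Matrix.vecMulVec (x (S n k)).ofLp (x (S n k)).ofLp

/-- The vector `b_t` at the start of round `n`. -/
def bvec (x : Fin L → EuclideanSpace ℝ (Fin d)) (S : ℕ → RecList K L) (W : ℕ → Fin L → Bool) :
    ℕ → EuclideanSpace ℝ (Fin d)
  | 0 => 0
  | n + 1 => bvec x S W n +
      ∑ k ∈ observed (S n) (W n), (if W n (S n k) = true then (1 : ℝ) else 0) • x (S n k)

/-- The estimate `ψ̂_t = M_t⁻¹ b_t` of `β` at the start of round `n`. -/
def psiHat (x : Fin L → EuclideanSpace ℝ (Fin d)) (S : ℕ → RecList K L) (W : ℕ → Fin L → Bool)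
    (n : ℕ) : EuclideanSpace ℝ (Fin d) :=
  Matrix.toEuclideanLin (gram x S W n)⁻¹ (bvec x S W n)

/-- `A ^ (-1/2)` for a positive definite real matrix `A`, by the functional calculus. -/
def invSqrt (A : Matrix (Fin d) (Fin d) ℝ) : Matrix (Fin d) (Fin d) ℝ :=
  cfc (fun s : ℝ => (√s)⁻¹) A

/-- The Thompson sample `ρ_t = ψ̂_t + λ v_t √K M_t^{-1/2} ξ_t` with `v_t = 3 √(d log t)`, in
round `n` (`t = n + 1`), where `z` is the Gaussian vector `ξ_t` drawn in that round. -/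
def thompson (lam : ℝ) (x : Fin L → EuclideanSpace ℝ (Fin d)) (S : ℕ → RecList K L)
    (W : ℕ → Fin L → Bool) (n : ℕ) (z : EuclideanSpace ℝ (Fin d)) : EuclideanSpace ℝ (Fin d) :=
  psiHat x S W n +
    (lam * (3 * √(d * Real.log ((n : ℝ) + 1))) * √K) •
      Matrix.toEuclideanLin (invSqrt (gram x S W n)) z

/-- `S = (i_1, …, i_K)` with `i_k ∈ argmax {score i : i ∉ {i_1, …, i_{k-1}}}` for every `k`. -/
def IsGreedy (score : Fin L → ℝ) (S : RecList K L) : Prop :=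
  ∀ k : Fin K, ∀ i : Fin L, (∀ j : Fin K, j < k → S j ≠ i) → score i ≤ score (S k)

/-- Everything that happened before round `n`: Gaussian vectors, lists, attractions. -/
def history {Ω : Type*} (ξ : ℕ → Ω → EuclideanSpace ℝ (Fin d)) (S : ℕ → Ω → RecList K L)
    (W : ℕ → Ω → Fin L → Bool) (n : ℕ) (ω : Ω) :
    Fin n → EuclideanSpace ℝ (Fin d) × (Fin K → Fin L) × (Fin L → Bool) :=
  fun m => (ξ m ω, ⇑(S m ω), W m ω)

/-- The random sequences `ξ` (Gaussian vectors), `S` (recommended lists) and `W` (attractions) on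
the probability space `(Ω, μ)` form a run of LinTS-Cascade(λ) with feature vectors `x` in the
linear cascading bandit with latent vector `β`. Ties in the argmax may be broken in any
(possibly random and history-dependent) way that does not look at present or future attractions. -/
structure IsLinTSCascadeRun {Ω : Type*} [MeasurableSpace Ω] (μ : Measure Ω) (lam : ℝ)
    (x : Fin L → EuclideanSpace ℝ (Fin d)) (β : EuclideanSpace ℝ (Fin d))
    (ξ : ℕ → Ω → EuclideanSpace ℝ (Fin d)) (S : ℕ → Ω → RecList K L)
    (W : ℕ → Ω → Fin L → Bool) : Prop where
  measurable_gauss : ∀ n, Measurable (ξ n)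
  measurable_list : ∀ n k, Measurable fun ω => S n ω k
  measurable_attr : ∀ n, Measurable (W n)
  /-- `ξ_t` is a standard Gaussian vector, ... -/
  law_gauss : ∀ n, μ.map (ξ n) = stdGaussian (EuclideanSpace ℝ (Fin d))
  /-- ... drawn independently of the past. -/
  indep_gauss : ∀ n, IndepFun (ξ n) (history ξ S W n) μ
  /-- The list is read off greedily from the scores `x(i)ᵀ ρ_t`. -/
  greedy : ∀ n, ∀ᵐ ω ∂μ, IsGreedy
    (fun i => inner ℝ (x i) (thompson lam x (fun m => S m ω) (fun m => W m ω) n (ξ n ω))) (S n ω)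
  /-- `W_t(i)` is Bernoulli with mean `w(i)`, ... -/
  law_attr : ∀ n i, μ.real {ω | W n ω i = true} = weight x β i
  /-- ... the items attract the user independently of each other ... -/
  indep_items : ∀ n, iIndepFun (fun i ω => W n ω i) μ
  /-- ... and of everything that happened before the user saw the list, the list included. -/
  indep_attr : ∀ n, IndepFun (W n) (fun ω => (history ξ S W n ω, ξ n ω, ⇑(S n ω))) μ

/-- Expected cumulative regret over the first `T` time steps:
`Reg(T) = 𝔼[∑_{t ≤ T} (r(S* | w) - r(S_t | w))]`. -/
def expRegret {Ω : Type*} [MeasurableSpace Ω] (μ : Measure Ω) (w : Fin L → ℝ)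
    (S : ℕ → Ω → RecList K L) (T : ℕ) : ℝ :=
  ∫ ω, ∑ n ∈ Finset.range T, (optReward K w - reward w (S n ω)) ∂μ

end

end CascadingBandit

/-! Let V be the scale of the Gaussian perturbation in a round, A the sum of ‖M^{-1/2} x(i)‖ over
the list shown, each item weighted by the probability that its position is seen (`listWidth`), and Z
the largest normalized Gaussian functional over the items (`maxAbsInner`). Apart from a probability
1/(n+1), the expected regret of round n is at most a constant times V · E[A(const + Z)]
(`integral_regret_le`). Cauchy–Schwarz over rounds and outcomes finishes the proof, because E Z² ≤ 7
min(d, log L) and the sum of E A² is O(K d log T).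

Accuracy. With s the accumulated centred noise, exp(sᵀM⁻¹s)/det M is a supermartingale started at 1
(`devPotential_step`, `cascadeMean_devPotential_le`). Markov's inequality and det M ≤ (n+1)^d then
bound the estimation error in every direction y by a multiple of V‖M^{-1/2}y‖, with probability at
least 1 - 1/(n+1).

Optimism. Scores are truncated to [0,1]; this keeps the greedy list optimal. For an optimal list S*,
one linear functional of the score errors being nonnegative already forces the truncated reward of
S* up to its true value (`exists_optimism_functional`). Under accuracy this event contains a
Gaussian half-space, so its probability is at least a constant c, independent of d, K and L. Hence
the optimal reward exceeds the mean optimistic value m by at most c⁻¹ times the mean positive part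
of (optimistic value - m). That excess is controlled by the width of the greedy list itself
(`optReward_clip_sub_integral_le`), which is the list shown.

Width. A telescoping product bounds the reward error of a list with the true seeing probabilities as
weights (`abs_prod_sub_prod_le`). These weights turn sums over the whole list into expected sums
over observed items, to which the elliptical potential inequality applies. Updating M only once per
round costs a factor e, since K‖x‖² ≤ 1. -/

namespace CascadingBandit

noncomputable section

open Matrix

variable {d K L : ℕ}

/-! ### The inverse quadratic form under rank-one updates -/

/-- The bilinear form `aᵀ M⁻¹ b`. -/
def invForm (M : Matrix (Fin d) (Fin d) ℝ) (a b : Fin d → ℝ) : ℝ := a ⬝ᵥ (M⁻¹ *ᵥ b)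

lemma invForm_add_left (M : Matrix (Fin d) (Fin d) ℝ) (a b c : Fin d → ℝ) :
    invForm M (a + b) c = invForm M a c + invForm M b c := by
  simp [invForm, add_dotProduct]

lemma invForm_add_right (M : Matrix (Fin d) (Fin d) ℝ) (a b c : Fin d → ℝ) :
    invForm M a (b + c) = invForm M a b + invForm M a c := by
  simp [invForm, mulVec_add, dotProduct_add]

lemma invForm_smul_left (M : Matrix (Fin d) (Fin d) ℝ) (t : ℝ) (a b : Fin d → ℝ) :
    invForm M (t • a) b = t * invForm M a b := by
  simp [invForm, smul_dotProduct]

lemma invForm_smul_right (M : Matrix (Fin d) (Fin d) ℝ) (t : ℝ) (a b : Fin d → ℝ) :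
    invForm M a (t • b) = t * invForm M a b := by
  simp [invForm, mulVec_smul, dotProduct_smul]

variable {M : Matrix (Fin d) (Fin d) ℝ}

lemma invForm_comm (hM : M.PosDef) (a b : Fin d → ℝ) : invForm M a b = invForm M b a := by
  have h : (M⁻¹)ᵀ = M⁻¹ := by
    have := hM.inv.isHermitian
    rwa [IsHermitian, conjTranspose_eq_transpose_of_trivial] at this
  unfold invForm
  rw [dotProduct_mulVec, dotProduct_comm, ← mulVec_transpose, h]

lemma invForm_self_nonneg (hM : M.PosDef) (a : Fin d → ℝ) : 0 ≤ invForm M a a := by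
  simpa [invForm] using hM.inv.posSemidef.dotProduct_mulVec_nonneg a

lemma invForm_sq_le (hM : M.PosDef) (a b : Fin d → ℝ) :
    invForm M a b ^ 2 ≤ invForm M a a * invForm M b b := by
  have h : ∀ t : ℝ, 0 ≤ invForm M b b * (t * t) + 2 * invForm M a b * t + invForm M a a := by
    intro t
    have := invForm_self_nonneg hM (a + t • b)
    simp only [invForm_add_left, invForm_add_right, invForm_smul_left, invForm_smul_right,
      invForm_comm hM b a] at this
    linarith
  have := discrim_le_zero h
  simp only [discrim] at this
  nlinarith

lemma abs_invForm_le (hM : M.PosDef) (a b : Fin d → ℝ) :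
    |invForm M a b| ≤ √(invForm M a a) * √(invForm M b b) := by
  rw [← Real.sqrt_mul (invForm_self_nonneg hM a)]
  exact Real.abs_le_sqrt (invForm_sq_le hM a b)

lemma posDef_add_vecMulVec (hM : M.PosDef) (x : Fin d → ℝ) : (M + vecMulVec x x).PosDef := by
  have := posSemidef_vecMulVec_self_star (R := ℝ) x
  rw [star_trivial] at this
  exact hM.add_posSemidef this

/-- The Sherman–Morrison formula. -/
lemma invForm_add_vecMulVec (hM : M.PosDef) (x a b : Fin d → ℝ) :
    invForm (M + vecMulVec x x) a b =
      invForm M a b - invForm M a x * invForm M x b / (1 + invForm M x x) := by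
  have hq := invForm_self_nonneg hM x
  have hdet : IsUnit M.det := (isUnit_iff_isUnit_det _).1 hM.isUnit
  have hdet' : IsUnit (M + vecMulVec x x).det :=
    (isUnit_iff_isUnit_det _).1 (posDef_add_vecMulVec hM x).isUnit
  set c : ℝ := invForm M x b / (1 + invForm M x x) with hc
  have key : (M + vecMulVec x x) *ᵥ (M⁻¹ *ᵥ b - c • M⁻¹ *ᵥ x) = b := by
    have e1 : ∀ y, vecMulVec x x *ᵥ y = (x ⬝ᵥ y) • x := by
      intro y; rw [vecMulVec_mulVec]; simp
    rw [add_mulVec, e1, mulVec_sub, mulVec_smul, mulVec_mulVec, mulVec_mulVec,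
      mul_nonsing_inv _ hdet, one_mulVec, one_mulVec, dotProduct_sub, dotProduct_smul]
    change b - c • x + (invForm M x b - c • invForm M x x) • x = b
    have : invForm M x b - c • invForm M x x = c := by
      rw [hc, smul_eq_mul]; field_simp; ring
    rw [this]; simp
  have h2 : (M + vecMulVec x x)⁻¹ *ᵥ b = M⁻¹ *ᵥ b - c • M⁻¹ *ᵥ x := by
    conv_lhs => rw [← key]
    rw [mulVec_mulVec, nonsing_inv_mul _ hdet', one_mulVec]
  unfold invForm at *
  rw [h2, dotProduct_sub, dotProduct_smul, smul_eq_mul, hc]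
  ring

lemma det_add_vecMulVec (hM : M.PosDef) (x : Fin d → ℝ) :
    (M + vecMulVec x x).det = M.det * (1 + invForm M x x) := by
  have hdet : IsUnit M.det := (isUnit_iff_isUnit_det _).1 hM.isUnit
  have := det_add_replicateCol_mul_replicateRow (ι := Unit) hdet x x
  rw [← vecMulVec_eq] at this
  rw [this, det_unique (n := Unit), Matrix.mul_assoc, ← replicateCol_mulVec,
    replicateRow_mul_replicateCol]
  rfl

lemma invForm_self_add_vecMulVec_le (hM : M.PosDef) (x a : Fin d → ℝ) :
    invForm (M + vecMulVec x x) a a ≤ invForm M a a := by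
  have hq := invForm_self_nonneg hM x
  rw [invForm_add_vecMulVec hM, invForm_comm hM x a]
  have : 0 ≤ invForm M a x * invForm M a x / (1 + invForm M x x) :=
    div_nonneg (mul_self_nonneg _) (by linarith)
  linarith

/-- Cauchy–Schwarz applied to the term subtracted in the Sherman–Morrison formula. -/
lemma div_le_invForm_self_add_vecMulVec (hM : M.PosDef) (x a : Fin d → ℝ) :
    invForm M a a / (1 + invForm M x x) ≤ invForm (M + vecMulVec x x) a a := by
  have hq := invForm_self_nonneg hM x
  rw [invForm_add_vecMulVec hM, invForm_comm hM x a, div_le_iff₀ (by linarith), sub_mul,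
    div_mul_cancel₀ _ (by linarith)]
  nlinarith [invForm_sq_le hM a x]

/-! ### Design matrices and the elliptical potential -/

/-- Positive definite matrices that dominate the identity matrix. -/
structure IsDesign (M : Matrix (Fin d) (Fin d) ℝ) : Prop where
  posDef : M.PosDef
  invForm_self_le : ∀ y, invForm M y y ≤ y ⬝ᵥ y

lemma isDesign_one : IsDesign (1 : Matrix (Fin d) (Fin d) ℝ) :=
  ⟨PosDef.one, fun y => by simp [invForm]⟩

lemma IsDesign.add_vecMulVec (hM : IsDesign M) (x : Fin d → ℝ) :
    IsDesign (M + vecMulVec x x) :=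
  ⟨posDef_add_vecMulVec hM.posDef x, fun y =>
    (invForm_self_add_vecMulVec_le hM.posDef x y).trans (hM.invForm_self_le y)⟩

lemma IsDesign.add_sum {ι : Type*} (hM : IsDesign M) (O : Finset ι) (x : ι → Fin d → ℝ) :
    IsDesign (M + ∑ k ∈ O, vecMulVec (x k) (x k)) := by
  classical
  induction O using Finset.induction_on with
  | empty => simpa using hM
  | insert k O hk ih =>
    rw [Finset.sum_insert hk, add_comm (vecMulVec _ _), ← add_assoc]
    exact ih.add_vecMulVec _

/-- Within one round, the form `M⁻¹` shrinks by at most a constant factor. -/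
lemma IsDesign.exp_mul_invForm_le {ι : Type*} (hM : IsDesign M) {r : ℝ} (O : Finset ι)
    (x : ι → Fin d → ℝ) (hx : ∀ k, x k ⬝ᵥ x k ≤ r) (y : Fin d → ℝ) :
    Real.exp (-(O.card * r)) * invForm M y y ≤
      invForm (M + ∑ k ∈ O, vecMulVec (x k) (x k)) y y := by
  classical
  induction O using Finset.induction_on with
  | empty => simp
  | insert k O hk ih =>
    rw [Finset.sum_insert hk, add_comm (vecMulVec _ _), ← add_assoc,
      Finset.card_insert_of_notMem hk]
    have hD := hM.add_sum O x
    set N := M + ∑ k ∈ O, vecMulVec (x k) (x k)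
    refine le_trans ?_ (div_le_invForm_self_add_vecMulVec hD.posDef (x k) y)
    have hq := invForm_self_nonneg hD.posDef (x k)
    have hqr := (hD.invForm_self_le (x k)).trans (hx k)
    rw [le_div_iff₀ (by linarith)]
    -- Each observed item costs one factor 1 + q ≤ 1 + r ≤ e^r.
    have h1 : 1 + invForm N (x k) (x k) ≤ Real.exp r := by
      linarith [Real.add_one_le_exp r]
    calc _ ≤ Real.exp (-((O.card + 1 : ℕ) * r)) * invForm M y y * Real.exp r := by
          gcongr
          exact mul_nonneg (Real.exp_pos _).le (invForm_self_nonneg hM.posDef y)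
      _ = Real.exp (-(O.card * r)) * invForm M y y := by
          rw [mul_right_comm, ← Real.exp_add]; push_cast; ring_nf
      _ ≤ _ := ih

/-- The elliptical potential inequality for one round. -/
lemma IsDesign.sum_invForm_le_log_det {ι : Type*} (hM : IsDesign M) {r : ℝ} (hr : r ≤ 1)
    (O : Finset ι) (hO : O.card * r ≤ 1) (x : ι → Fin d → ℝ) (hx : ∀ k, x k ⬝ᵥ x k ≤ r) :
    Real.exp (-1) / 2 * ∑ k ∈ O, invForm M (x k) (x k) ≤
      Real.log (M + ∑ k ∈ O, vecMulVec (x k) (x k)).det - Real.log M.det := by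
  classical
  induction O using Finset.induction_on with
  | empty => simp
  | insert k O hk ih =>
    have hr0 : 0 ≤ r := le_trans (by simpa using dotProduct_star_self_nonneg (x k)) (hx k)
    rw [Finset.card_insert_of_notMem hk] at hO
    push_cast at hO
    have hO' : O.card * r ≤ 1 := by linarith
    have ih := ih hO'
    rw [Finset.sum_insert hk, Finset.sum_insert hk, add_comm (vecMulVec _ _), ← add_assoc]
    have hlow := hM.exp_mul_invForm_le O x hx (x k)
    have hD := hM.add_sum O x
    set N := M + ∑ k ∈ O, vecMulVec (x k) (x k)
    rw [det_add_vecMulVec hD.posDef]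
    have hq := invForm_self_nonneg hD.posDef (x k)
    have hqr := ((hD.invForm_self_le (x k)).trans (hx k)).trans hr
    have hqM := invForm_self_nonneg hM.posDef (x k)
    rw [Real.log_mul hD.posDef.det_pos.ne' (by linarith)]
    -- log(1 + q) ≥ q/(1 + q) ≥ q/2, because q ≤ r ≤ 1.
    have h1 : invForm N (x k) (x k) / 2 ≤ Real.log (1 + invForm N (x k) (x k)) := by
      refine le_trans ?_ (Real.one_sub_inv_le_log_of_pos (by linarith))
      rw [inv_eq_one_div, le_sub_iff_add_le, ← le_sub_iff_add_le', div_le_iff₀ (by linarith)]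
      nlinarith
    -- The sum uses the matrix from the start of the round, the determinant the current one; since
    -- `O.card * r ≤ 1`, this delay costs at most a factor e.
    have h2 : Real.exp (-1) * invForm M (x k) (x k) ≤ Real.exp (-(O.card * r)) * invForm M (x k) (x k) := by
      gcongr
    linarith

lemma det_le_pow_of_form_le (hM : M.PosDef) {c : ℝ} (h : ∀ y, y ⬝ᵥ (M *ᵥ y) ≤ c * (y ⬝ᵥ y)) :
    M.det ≤ c ^ d := by
  rw [hM.isHermitian.det_eq_prod_eigenvalues]
  calc _ = ∏ i, hM.isHermitian.eigenvalues i := by simp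
    _ ≤ ∏ _i : Fin d, c := by
        refine Finset.prod_le_prod (fun i _ => (hM.eigenvalues_pos i).le) fun i _ => ?_
        rw [hM.isHermitian.eigenvalues_eq]
        set v := hM.isHermitian.eigenvectorBasis i with hv
        have := h v.ofLp
        have h1 : v.ofLp ⬝ᵥ v.ofLp = 1 := by
          have := hM.isHermitian.eigenvectorBasis.norm_eq_one i
          rw [← hv] at this
          have h2 := real_inner_self_eq_norm_sq v
          rw [this] at h2
          rw [EuclideanSpace.inner_eq_star_dotProduct, star_trivial] at h2
          linarith
        rw [h1, mul_one] at this
        simpa using this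
    _ = c ^ d := by simp

/-! ### The inverse square root -/

lemma invSqrt_mul_self (hM : M.PosDef) : invSqrt M * invSqrt M = M⁻¹ := by
  -- Every function is continuous on a finite spectrum, so the discontinuity of the inverse root at
  -- 0 does no harm.
  have hfin : (spectrum ℝ M).Finite := Matrix.finite_real_spectrum
  have hc : ∀ f : ℝ → ℝ, ContinuousOn f (spectrum ℝ M) := fun f => hfin.continuousOn f
  have hpos : ∀ s ∈ spectrum ℝ M, 0 < s := by
    intro s hs
    rw [hM.isHermitian.spectrum_real_eq_range_eigenvalues] at hs
    obtain ⟨i, rfl⟩ := hs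
    exact hM.eigenvalues_pos i
  have hsa : IsSelfAdjoint M := hM.isHermitian.isSelfAdjoint
  unfold invSqrt
  rw [← cfc_mul _ _ _ (hc _) (hc _)]
  symm
  apply inv_eq_left_inv
  conv_lhs => rhs; rw [← cfc_id ℝ M]
  rw [← cfc_mul _ _ _ (hc _) (hc _), ← cfc_one ℝ M]
  apply cfc_congr
  intro s hs
  have := hpos s hs
  simp only [id, Pi.one_apply]
  rw [← mul_inv, Real.mul_self_sqrt this.le, inv_mul_cancel₀ this.ne']

lemma transpose_invSqrt (M : Matrix (Fin d) (Fin d) ℝ) : (invSqrt M)ᵀ = invSqrt M := by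
  have : IsSelfAdjoint (invSqrt M) := cfc_predicate _ _
  rw [IsSelfAdjoint, star_eq_conjTranspose, conjTranspose_eq_transpose_of_trivial] at this
  exact this

lemma inner_eq_dotProduct (a b : EuclideanSpace ℝ (Fin d)) : inner ℝ a b = a.ofLp ⬝ᵥ b.ofLp := by
  rw [EuclideanSpace.inner_eq_star_dotProduct, star_trivial, dotProduct_comm]

lemma ofLp_toEuclideanLin (A : Matrix (Fin d) (Fin d) ℝ) (v : EuclideanSpace ℝ (Fin d)) :
    (Matrix.toEuclideanLin A v).ofLp = A *ᵥ v.ofLp := rfl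

lemma inner_toEuclideanLin_invSqrt (a z : EuclideanSpace ℝ (Fin d)) :
    inner ℝ a (Matrix.toEuclideanLin (invSqrt M) z) =
      inner ℝ (Matrix.toEuclideanLin (invSqrt M) a) z := by
  rw [inner_eq_dotProduct, inner_eq_dotProduct, ofLp_toEuclideanLin,
    ofLp_toEuclideanLin, dotProduct_mulVec, ← mulVec_transpose, transpose_invSqrt]

lemma norm_sq_toEuclideanLin_invSqrt (hM : M.PosDef) (a : EuclideanSpace ℝ (Fin d)) :
    ‖Matrix.toEuclideanLin (invSqrt M) a‖ ^ 2 = invForm M a.ofLp a.ofLp := by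
  rw [← real_inner_self_eq_norm_sq, ← inner_toEuclideanLin_invSqrt, inner_eq_dotProduct,
    ofLp_toEuclideanLin, ofLp_toEuclideanLin, mulVec_mulVec,
    invSqrt_mul_self hM, invForm]

/-! ### Cascades of Bernoulli variables -/

/-- The Bernoulli probability of a Boolean value. -/
def bernWeight (p : ℝ) (b : Bool) : ℝ := if b then p else 1 - p

/-- Expectation over independent Bernoulli variables with means `w k`. -/
def cascadeMean (w : Fin K → ℝ) (g : (Fin K → Bool) → ℝ) : ℝ :=
  ∑ V : Fin K → Bool, (∏ k, bernWeight (w k) (V k)) * g V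

/-- The positions up to and including the first `true`. -/
def seen (V : Fin K → Bool) : Finset (Fin K) :=
  Finset.univ.filter fun k => ∀ j, j < k → V j = false

/-- The probability that position `k` is observed. -/
def viewProb (w : Fin K → ℝ) (k : Fin K) : ℝ := ∏ j, if j < k then 1 - w j else 1

/-- Passing to the K bits along the list makes feedback accessible to induction on the head of the
list. -/
lemma observed_eq_seen (S : RecList K L) (W : Fin L → Bool) :
    observed S W = seen fun k => W (S k) := by
  ext k
  simp only [observed, clickPos, seen, Finset.mem_filter, Finset.mem_univ, true_and,
    Finset.le_min_iff, WithTop.coe_le_coe]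
  constructor
  · intro h j hj
    by_contra hW
    exact absurd (h j (by simpa using hW)) (not_le.2 hj)
  · intro h j hj
    by_contra hk
    simp [h j (not_le.1 hk)] at hj

lemma sum_fin_succ_bool (f : (Fin (K + 1) → Bool) → ℝ) :
    ∑ V, f V = ∑ V : Fin K → Bool, f (Fin.cons true V) + ∑ V : Fin K → Bool, f (Fin.cons false V) := by
  rw [← (Fin.consEquiv fun _ : Fin (K + 1) => Bool).sum_comp, Fintype.sum_prod_type,
    Fintype.sum_bool]
  rfl

lemma cascadeMean_succ (w : Fin (K + 1) → ℝ) (g : (Fin (K + 1) → Bool) → ℝ) :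
    cascadeMean w g = w 0 * cascadeMean (fun k => w k.succ) (fun V => g (Fin.cons true V)) +
      (1 - w 0) * cascadeMean (fun k => w k.succ) (fun V => g (Fin.cons false V)) := by
  simp only [cascadeMean]
  rw [sum_fin_succ_bool, Finset.mul_sum, Finset.mul_sum]
  simp only [Fin.prod_univ_succ, Fin.cons_zero, Fin.cons_succ, bernWeight, if_true,
    Bool.false_eq_true, if_false, mul_assoc]

lemma cascadeMean_const (w : Fin K → ℝ) (c : ℝ) : cascadeMean w (fun _ => c) = c := by
  induction K with
  | zero => simp [cascadeMean]
  | succ K ih => rw [cascadeMean_succ, ih]; ring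

lemma cascadeMean_add (w : Fin K → ℝ) (f g : (Fin K → Bool) → ℝ) :
    cascadeMean w (fun V => f V + g V) = cascadeMean w f + cascadeMean w g := by
  simp [cascadeMean, mul_add, Finset.sum_add_distrib]

/-- A click at the head hides the tail. The summand may depend on the bit as well, so that the same
recursion serves the noise. -/
lemma sum_seen_cons {A : Type*} [AddCommMonoid A] (b : Bool) (V : Fin K → Bool)
    (f : Bool → Fin (K + 1) → A) :
    ∑ k ∈ seen (Fin.cons b V : Fin (K + 1) → Bool), f ((Fin.cons b V : Fin (K + 1) → Bool) k) k =
      f b 0 + if b then 0 else ∑ k ∈ seen V, f (V k) k.succ := by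
  simp only [seen, Finset.sum_filter, Fin.sum_univ_succ, Fin.cons_zero, Fin.cons_succ]
  have h0 : ∀ j : Fin (K + 1), j < 0 → (Fin.cons b V : Fin (K + 1) → Bool) j = false := by
    intro j hj; exact absurd hj (Fin.not_lt_zero j)
  have hs : ∀ k : Fin K, (∀ j : Fin (K + 1), j < k.succ →
      (Fin.cons b V : Fin (K + 1) → Bool) j = false) ↔ b = false ∧ ∀ j, j < k → V j = false := by
    intro k
    simp [Fin.forall_fin_succ, Fin.succ_pos]
  rw [if_pos h0]
  cases b <;> simp [hs]

lemma sum_fin_viewProb_succ (w : Fin (K + 1) → ℝ) (f : Fin (K + 1) → ℝ) :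
    ∑ k, viewProb w k * f k =
      f 0 + (1 - w 0) * ∑ k, viewProb (fun k => w k.succ) k * f k.succ := by
  rw [Fin.sum_univ_succ, Finset.mul_sum]
  simp [viewProb, Fin.prod_univ_succ, mul_assoc]

lemma viewProb_nonneg {w : Fin K → ℝ} (hw : ∀ k, w k ∈ Set.Icc (0 : ℝ) 1) (k : Fin K) :
    0 ≤ viewProb w k := by
  refine Finset.prod_nonneg fun j _ => ?_
  split_ifs <;> linarith [(hw j).2]

lemma viewProb_le_one {w : Fin K → ℝ} (hw : ∀ k, w k ∈ Set.Icc (0 : ℝ) 1) (k : Fin K) :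
    viewProb w k ≤ 1 := by
  refine Finset.prod_le_one (fun j _ => ?_) fun j _ => ?_ <;>
  split_ifs <;> linarith [(hw j).1, (hw j).2]

lemma cascadeMean_sum_seen (w : Fin K → ℝ) (f : Fin K → ℝ) :
    cascadeMean w (fun V => ∑ k ∈ seen V, f k) = ∑ k, viewProb w k * f k := by
  induction K with
  | zero => simp [cascadeMean, seen]
  | succ K ih =>
    rw [cascadeMean_succ, sum_fin_viewProb_succ, ← ih]
    simp only [fun b V => sum_seen_cons (K := K) b V (fun _ k => f k), if_true,
      Bool.false_eq_true, if_false, cascadeMean_add, cascadeMean_const]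
    ring

/-- Replacing factors one at a time leaves `w`-factors before position k and `a`-factors, at most 1,
after it. The `w`-factors multiply to the true probability of seeing k, which is the weight matched
by the feedback. -/
lemma abs_prod_sub_prod_le {a w : Fin K → ℝ} (ha : ∀ k, a k ∈ Set.Icc (0 : ℝ) 1)
    (hw : ∀ k, w k ∈ Set.Icc (0 : ℝ) 1) :
    |∏ k, (1 - a k) - ∏ k, (1 - w k)| ≤ ∑ k, viewProb w k * |a k - w k| := by
  induction K with
  | zero => simp
  | succ K ih =>
    rw [sum_fin_viewProb_succ w fun k => |a k - w k|, Fin.prod_univ_succ, Fin.prod_univ_succ]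
    have ih := ih (fun k => ha k.succ) (fun k => hw k.succ)
    set A := ∏ k : Fin K, (1 - a k.succ)
    set W := ∏ k : Fin K, (1 - w k.succ)
    have hA0 : 0 ≤ A := Finset.prod_nonneg fun k _ => by linarith [(ha k.succ).2]
    have hA1 : A ≤ 1 := Finset.prod_le_one (fun k _ => by linarith [(ha k.succ).2])
      fun k _ => by linarith [(ha k.succ).1]
    have e : (1 - a 0) * A - (1 - w 0) * W = -((a 0 - w 0) * A) + (1 - w 0) * (A - W) := by ring
    rw [e]
    refine (abs_add_le _ _).trans (add_le_add ?_ ?_)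
    · rw [abs_neg, abs_mul, abs_of_nonneg hA0]
      exact mul_le_of_le_one_right (abs_nonneg _) hA1
    · have : 0 ≤ 1 - w 0 := by linarith [(hw 0).2]
      rw [abs_mul, abs_of_nonneg this]
      exact mul_le_mul_of_nonneg_left ih this

lemma abs_reward_sub_reward_le {a w : Fin L → ℝ} (ha : ∀ k, a k ∈ Set.Icc (0 : ℝ) 1)
    (hw : ∀ k, w k ∈ Set.Icc (0 : ℝ) 1) (S : RecList K L) :
    |reward a S - reward w S| ≤ ∑ k, viewProb (fun k => w (S k)) k * |a (S k) - w (S k)| := by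
  refine le_trans (le_of_eq ?_) (abs_prod_sub_prod_le (fun k => ha (S k)) fun k => hw (S k))
  rw [abs_sub_comm]
  simp [reward]

/-! ### The self-normalized deviation supermartingale -/

/-- Hoeffding's lemma for a centred Bernoulli variable. -/
lemma bernoulli_mgf_le {w : ℝ} (hw : w ∈ Set.Icc (0 : ℝ) 1) (t : ℝ) :
    w * Real.exp (t * (1 - w)) + (1 - w) * Real.exp (t * (0 - w)) ≤ Real.exp (t ^ 2 / 8) := by
  obtain ⟨h0, h1⟩ := hw
  have h1' : 0 ≤ 1 - w := by linarith
  -- The two-point law lives on [0,1], so the bounded-variable form of Hoeffding's lemma gives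
  -- variance proxy 1/4.
  let μ : Measure ℝ := ENNReal.ofReal w • Measure.dirac 1 + ENNReal.ofReal (1 - w) • Measure.dirac 0
  have : IsProbabilityMeasure μ := ⟨by
    simp only [μ, Measure.add_apply, Measure.smul_apply, measure_univ, smul_eq_mul, mul_one]
    rw [← ENNReal.ofReal_add h0 h1']; simp⟩
  have hint : ∀ f : ℝ → ℝ, ∫ y, f y ∂μ = w * f 1 + (1 - w) * f 0 := by
    intro f
    have hi : ∀ (c : ℝ) (y : ℝ), Integrable f (ENNReal.ofReal c • Measure.dirac y) := fun c y =>
      (integrable_dirac (by simp)).smul_measure ENNReal.ofReal_ne_top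
    rw [integral_add_measure (hi _ _) (hi _ _), integral_smul_measure, integral_smul_measure,
      integral_dirac, integral_dirac, ENNReal.toReal_ofReal h0, ENNReal.toReal_ofReal h1']
    simp
  have hmem : ∀ᵐ y ∂μ, id y ∈ Set.Icc (0 : ℝ) 1 := by
    simp only [μ, ae_add_measure_iff]
    constructor <;> refine Measure.ae_smul_measure ?_ _ <;> simp [ae_dirac_eq]
  have h := (hasSubgaussianMGF_of_mem_Icc (X := id) aemeasurable_id hmem).mgf_le t
  rw [mgf, hint, hint] at h
  simp only [id, mul_one, mul_zero, add_zero] at h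
  refine h.trans (le_of_eq ?_)
  congr 1
  simp
  ring

/-- The potential behind the self-normalized deviation inequality. -/
def devPotential (M : Matrix (Fin d) (Fin d) ℝ) (s : Fin d → ℝ) : ℝ :=
  Real.exp (invForm M s s) / M.det

lemma devPotential_nonneg {M : Matrix (Fin d) (Fin d) ℝ} (hM : M.PosDef) (s : Fin d → ℝ) :
    0 ≤ devPotential M s := div_nonneg (Real.exp_pos _).le hM.det_pos.le

/-- By Sherman–Morrison the exponent gains 2aη/(1+q) - a²/(1+q) + η²q/(1+q), where η is the new
noise, a = sᵀM⁻¹x and q = xᵀM⁻¹x. The last term is paid by the growth 1+q of the determinant, and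
averaging the linear term costs at most a²/(2(1+q)²), which the negative term covers. -/
lemma devPotential_step {M : Matrix (Fin d) (Fin d) ℝ} (hM : M.PosDef) (s x : Fin d → ℝ) {w : ℝ}
    (hw : w ∈ Set.Icc (0 : ℝ) 1) :
    w * devPotential (M + vecMulVec x x) (s + (1 - w) • x) +
      (1 - w) * devPotential (M + vecMulVec x x) (s + (0 - w) • x) ≤ devPotential M s := by
  have hq := invForm_self_nonneg hM x
  have hdet := hM.det_pos
  set q := invForm M x x with hq_def
  set a := invForm M s x with ha
  have hq1 : 0 < 1 + q := by linarith
  have key : ∀ η : ℝ, η ^ 2 ≤ 1 → devPotential (M + vecMulVec x x) (s + η • x) ≤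
      devPotential M s * Real.exp (-(a ^ 2 / (1 + q))) * Real.exp (2 * a / (1 + q) * η) := by
    intro η hη
    have e1 : invForm (M + vecMulVec x x) (s + η • x) (s + η • x) =
        invForm M s s + (2 * a / (1 + q) * η - a ^ 2 / (1 + q)) + η ^ 2 * (q / (1 + q)) := by
      rw [invForm_add_vecMulVec hM]
      simp only [invForm_add_left, invForm_add_right, invForm_smul_left, invForm_smul_right,
        invForm_comm hM x s]
      rw [← ha, ← hq_def]
      field_simp
      ring
    -- Uses η² ≤ 1 and q/(1+q) ≤ log(1+q).
    have e2 : Real.exp (η ^ 2 * (q / (1 + q))) ≤ 1 + q := by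
      rw [← Real.le_log_iff_exp_le hq1]
      refine le_trans (mul_le_of_le_one_left (by positivity) hη) ?_
      refine le_trans (le_of_eq ?_) (Real.one_sub_inv_le_log_of_pos hq1)
      field_simp
      ring
    have e3 : invForm M s s + (2 * a / (1 + q) * η - a ^ 2 / (1 + q)) =
      invForm M s s + -(a ^ 2 / (1 + q)) + 2 * a / (1 + q) * η := by ring
    unfold devPotential
    rw [e1, det_add_vecMulVec hM, ← hq_def, e3, Real.exp_add, Real.exp_add, Real.exp_add,
      div_le_iff₀ (by positivity)]
    calc _ ≤ Real.exp (invForm M s s) * Real.exp (-(a ^ 2 / (1 + q))) *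
          Real.exp (2 * a / (1 + q) * η) * (1 + q) := by gcongr
      _ = _ := by
          rw [show ∀ b c e : ℝ, b / M.det * c * e * (M.det * (1 + q)) =
            b * c * e * (1 + q) * (M.det / M.det) by intros; ring, div_self hdet.ne', mul_one]
  have hH := bernoulli_mgf_le hw (2 * a / (1 + q))
  have h1 := key (1 - w) (by nlinarith [hw.1, hw.2])
  have h2 := key (0 - w) (by nlinarith [hw.1, hw.2])
  have hP := devPotential_nonneg hM s
  have hle : Real.exp ((2 * a / (1 + q)) ^ 2 / 8) ≤ Real.exp (a ^ 2 / (1 + q)) := by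
    rw [Real.exp_le_exp, div_pow, div_div, div_le_div_iff₀ (by positivity) hq1]
    nlinarith [sq_nonneg a, mul_nonneg (sq_nonneg a) hq, mul_nonneg (mul_nonneg (sq_nonneg a) hq) hq]
  have hw1 : 0 ≤ 1 - w := by linarith [hw.2]
  set c := devPotential M s * Real.exp (-(a ^ 2 / (1 + q))) with hc
  have hc0 : 0 ≤ c := by positivity
  calc _ ≤ w * (c * Real.exp (2 * a / (1 + q) * (1 - w))) +
        (1 - w) * (c * Real.exp (2 * a / (1 + q) * (0 - w))) := by
        gcongr; exact hw.1
    _ = c * (w * Real.exp (2 * a / (1 + q) * (1 - w)) +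
        (1 - w) * Real.exp (2 * a / (1 + q) * (0 - w))) := by ring
    _ ≤ c * Real.exp (a ^ 2 / (1 + q)) := by gcongr; exact hH.trans hle
    _ = devPotential M s := by
        rw [hc, mul_assoc, ← Real.exp_add, neg_add_cancel, Real.exp_zero, mul_one]

/-- The deviation potential does not grow in expectation over one cascade. -/
lemma cascadeMean_devPotential_le {w : Fin K → ℝ} (hw : ∀ k, w k ∈ Set.Icc (0 : ℝ) 1)
    (x : Fin K → Fin d → ℝ) {M : Matrix (Fin d) (Fin d) ℝ} (hM : M.PosDef) (s : Fin d → ℝ) :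
    cascadeMean w (fun V => devPotential (M + ∑ k ∈ seen V, vecMulVec (x k) (x k))
      (s + ∑ k ∈ seen V, ((if V k = true then 1 else 0) - w k) • x k)) ≤ devPotential M s := by
  induction K generalizing M s with
  | zero => simp [cascadeMean, seen]
  | succ K ih =>
    rw [cascadeMean_succ]
    refine le_trans (add_le_add ?_ ?_) (devPotential_step hM s (x 0) (hw 0))
    -- After a click at the head nothing further is observed, so the potential is constant over the
    -- tail.
    · simp only [fun b V => sum_seen_cons (K := K) b V (fun _ k => vecMulVec (x k) (x k)),
        fun b V => sum_seen_cons (K := K) b V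
          (fun c k => ((if c = true then 1 else 0) - w k) • x k), if_true, add_zero,
        cascadeMean_const]
      exact le_rfl
    · refine mul_le_mul_of_nonneg_left ?_ (by linarith [(hw 0).2])
      simp only [fun b V => sum_seen_cons (K := K) b V (fun _ k => vecMulVec (x k) (x k)),
        fun b V => sum_seen_cons (K := K) b V
          (fun c k => ((if c = true then 1 else 0) - w k) • x k), Bool.false_eq_true, if_false]
      simp only [← add_assoc]
      exact ih (fun k => hw k.succ) (fun k => x k.succ) (posDef_add_vecMulVec hM (x 0)) _

/-! ### Truncated scores and optimism -/

/-- Scores truncated to `[0, 1]`. -/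
def clip (u : Fin L → ℝ) (i : Fin L) : ℝ := max 0 (min (u i) 1)

lemma clip_mem (u : Fin L → ℝ) (i : Fin L) : clip u i ∈ Set.Icc (0 : ℝ) 1 :=
  ⟨le_max_left _ _, max_le zero_le_one (min_le_right _ _)⟩

lemma clip_le_clip {u : Fin L → ℝ} {i j : Fin L} (h : u i ≤ u j) : clip u i ≤ clip u j :=
  max_le_max le_rfl (min_le_min h le_rfl)

lemma abs_clip_sub_le (u : Fin L → ℝ) (i : Fin L) {a : ℝ} (ha : a ∈ Set.Icc (0 : ℝ) 1) :
    |clip u i - a| ≤ |u i - a| := by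
  obtain ⟨h0, h1⟩ := ha
  unfold clip
  rcases le_total (u i) 0 with h | h
  · rw [min_eq_left (by linarith), max_eq_left h, abs_of_nonpos (by linarith),
      abs_of_nonpos (by linarith)]
    linarith
  · rcases le_total (u i) 1 with h' | h'
    · rw [min_eq_left h', max_eq_right h]
    · rw [min_eq_right h', max_eq_right zero_le_one, abs_of_nonneg (by linarith),
        abs_of_nonneg (by linarith)]
      linarith

lemma reward_mem {w : Fin L → ℝ} (hw : ∀ i, w i ∈ Set.Icc (0 : ℝ) 1) (S : RecList K L) :
    reward w S ∈ Set.Icc (0 : ℝ) 1 := by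
  have h0 : 0 ≤ ∏ k, (1 - w (S k)) := Finset.prod_nonneg fun k _ => by linarith [(hw (S k)).2]
  have h1 : ∏ k, (1 - w (S k)) ≤ 1 := Finset.prod_le_one
    (fun k _ => by linarith [(hw (S k)).2]) fun k _ => by linarith [(hw (S k)).1]
  constructor <;> unfold reward <;> linarith

lemma reward_le_optReward (w : Fin L → ℝ) (S : RecList K L) : reward w S ≤ optReward K w :=
  le_ciSup (Set.finite_range fun S : RecList K L => reward w S).bddAbove S

lemma exists_reward_eq_optReward [Nonempty (RecList K L)] (w : Fin L → ℝ) :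
    ∃ S : RecList K L, reward w S = optReward K w := exists_eq_ciSup_of_finite

lemma optReward_mem [Nonempty (RecList K L)] {w : Fin L → ℝ}
    (hw : ∀ i, w i ∈ Set.Icc (0 : ℝ) 1) : optReward K w ∈ Set.Icc (0 : ℝ) 1 := by
  obtain ⟨S, hS⟩ := exists_reward_eq_optReward (K := K) w
  rw [← hS]
  exact reward_mem hw S

/-- A greedy list is optimal for the truncated scores. -/
lemma IsGreedy.optReward_clip_eq {u : Fin L → ℝ} {S : RecList K L} (h : IsGreedy u S) :
    optReward K (clip u) = reward (clip u) S := by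
  classical
  have : Nonempty (RecList K L) := ⟨S⟩
  refine le_antisymm (ciSup_le fun S' => ?_) (reward_le_optReward _ S)
  unfold reward
  refine sub_le_sub_left ?_ 1
  rcases isEmpty_or_nonempty (Fin K) with hK | hK
  · simp
  -- The lowest score in the greedy list separates it from its complement; the two set differences
  -- have equal size, so their products compare through this one value.
  obtain ⟨k₀, -, hk₀⟩ := Finset.exists_min_image Finset.univ (fun k => u (S k))
    Finset.univ_nonempty
  set A := Finset.univ.map S'
  set B := Finset.univ.map S
  have hA : ∏ k, (1 - clip u (S' k)) = ∏ i ∈ A, (1 - clip u i) := by simp [A]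
  have hB : ∏ k, (1 - clip u (S k)) = ∏ i ∈ B, (1 - clip u i) := by simp [B]
  have hc : (A \ B).card = (B \ A).card := Finset.card_sdiff_comm (by simp [A, B])
  have hnn : ∀ i, 0 ≤ 1 - clip u i := fun i => by linarith [(clip_mem u i).2]
  rw [hA, hB, ← Finset.prod_inter_mul_prod_sdiff A B, ← Finset.prod_inter_mul_prod_sdiff B A,
    Finset.inter_comm A B]
  refine mul_le_mul_of_nonneg_left ?_ (Finset.prod_nonneg fun i _ => hnn i)
  calc ∏ i ∈ B \ A, (1 - clip u i) ≤ ∏ _i ∈ B \ A, (1 - clip u (S k₀)) := by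
        refine Finset.prod_le_prod (fun i _ => hnn i) fun i hi => ?_
        obtain ⟨k, -, rfl⟩ := Finset.mem_map.1 (Finset.mem_sdiff.1 hi).1
        linarith [clip_le_clip (hk₀ k (Finset.mem_univ k))]
    _ = ∏ _i ∈ A \ B, (1 - clip u (S k₀)) := by simp [hc]
    _ ≤ ∏ i ∈ A \ B, (1 - clip u i) := by
        refine Finset.prod_le_prod (fun i _ => hnn _) fun i hi => ?_
        have hi' := (Finset.mem_sdiff.1 hi).2
        have : u i ≤ u (S k₀) := h k₀ i fun j _ hj =>
          hi' (Finset.mem_map.2 ⟨j, Finset.mem_univ j, hj⟩)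
        linarith [clip_le_clip this]

/-- If a suitable linear functional of the score errors is nonnegative, the truncated scores are
optimistic for the list `S`. -/
lemma exists_optimism_functional {w : Fin L → ℝ} (hw : ∀ i, w i ∈ Set.Icc (0 : ℝ) 1)
    (S : RecList K L) : ∃ a : Fin K → ℝ, ∀ u : Fin L → ℝ,
      0 ≤ ∑ k, a k * (u (S k) - w (S k)) → reward w S ≤ reward (clip u) S := by
  classical
  -- If some weight is 1, a score of at least 1 for that item alone gives reward 1; otherwise all
  -- the inverses used below make sense.
  by_cases h1 : ∃ k, w (S k) = 1
  · obtain ⟨k, hk⟩ := h1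
    refine ⟨Pi.single k 1, fun u hu => ?_⟩
    simp only [Pi.single_apply, ite_mul, one_mul, zero_mul, Finset.sum_ite_eq', Finset.mem_univ,
      if_true, hk] at hu
    have hc : clip u (S k) = 1 := by
      rw [clip, min_eq_right (by linarith), max_eq_right zero_le_one]
    have : reward (clip u) S = 1 := by
      rw [reward, Finset.prod_eq_zero (Finset.mem_univ k) (by rw [hc]; ring)]; ring
    rw [this]
    exact (reward_mem hw S).2
  · push Not at h1
    have hlt : ∀ k, 0 < 1 - w (S k) := fun k => by
      have := lt_of_le_of_ne (hw (S k)).2 (h1 k); linarith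
    -- 1 - u = (1-w)(1 - (u-w)/(1-w)) ≤ (1-w) exp(-(u-w)/(1-w)): the exponents add up to a linear
    -- functional of the errors.
    refine ⟨fun k => (1 - w (S k))⁻¹, fun u hu => ?_⟩
    unfold reward
    refine sub_le_sub_left ?_ 1
    have hle : ∀ k, 1 - clip u (S k) ≤
        (1 - w (S k)) * Real.exp (-((1 - w (S k))⁻¹ * (u (S k) - w (S k)))) := by
      intro k
      rcases le_total (u (S k)) 1 with h | h
      · have h2 : u (S k) ≤ clip u (S k) := by
          rw [clip, min_eq_left h]; exact le_max_right _ _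
        have h3 := Real.add_one_le_exp (-((1 - w (S k))⁻¹ * (u (S k) - w (S k))))
        have h4 := mul_le_mul_of_nonneg_left h3 (hlt k).le
        have h5 : (1 - w (S k)) * (-((1 - w (S k))⁻¹ * (u (S k) - w (S k))) + 1) =
            1 - u (S k) := by
          field_simp [(hlt k).ne']; ring
        linarith
      · have : clip u (S k) = 1 := by
          rw [clip, min_eq_right h, max_eq_right zero_le_one]
        rw [this, sub_self]
        exact mul_nonneg (hlt k).le (Real.exp_pos _).le
    calc ∏ k, (1 - clip u (S k)) ≤
        ∏ k, (1 - w (S k)) * Real.exp (-((1 - w (S k))⁻¹ * (u (S k) - w (S k)))) :=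
          Finset.prod_le_prod (fun k _ => by linarith [(clip_mem u (S k)).2]) fun k _ => hle k
      _ = (∏ k, (1 - w (S k))) * Real.exp (-∑ k, (1 - w (S k))⁻¹ * (u (S k) - w (S k))) := by
          rw [Finset.prod_mul_distrib, ← Real.exp_sum, Finset.sum_neg_distrib]
      _ ≤ (∏ k, (1 - w (S k))) * 1 := by
          gcongr
          · exact Finset.prod_nonneg fun k _ => (hlt k).le
          · rw [Real.exp_le_one_iff]; linarith
      _ = _ := mul_one _

/-! ### Estimates for Gaussian functionals -/

lemma stdGaussian_map_inner (y : EuclideanSpace ℝ (Fin d)) :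
    (stdGaussian (EuclideanSpace ℝ (Fin d))).map (fun z => inner ℝ y z) =
      gaussianReal 0 (‖y‖ ^ 2).toNNReal := by
  have h := IsGaussian.map_eq_gaussianReal (μ := stdGaussian (EuclideanSpace ℝ (Fin d)))
    (innerSL ℝ y)
  rw [integral_strongDual_stdGaussian, variance_dual_stdGaussian, innerSL_apply_norm] at h
  exact h

/-- The half-space has the standard normal tail at `G` as its probability, whatever the dimension
and the direction; this is where dimension-free optimism comes from. -/
lemma exists_pos_le_stdGaussian_real (G : ℝ) : ∃ c : ℝ, 0 < c ∧
    ∀ (d : ℕ) (y : EuclideanSpace ℝ (Fin d)), c ≤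
      (stdGaussian (EuclideanSpace ℝ (Fin d))).real {z | G * ‖y‖ ≤ inner ℝ y z} := by
  have hpos : 0 < (gaussianReal 0 1).real (Set.Ici G) := by
    rw [measureReal_def]
    refine ENNReal.toReal_pos (fun h => ?_) (measure_ne_top _ _)
    have := gaussianReal_absolutelyContinuous' 0 one_ne_zero h
    simp at this
  refine ⟨(gaussianReal 0 1).real (Set.Ici G), hpos, fun d y => ?_⟩
  rcases eq_or_ne y 0 with rfl | hy
  · simp only [norm_zero, mul_zero, inner_zero_left, le_refl, Set.ofPred_true, probReal_univ]
    exact measureReal_le_one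
  · have hy' : 0 < ‖y‖ := norm_pos_iff.2 hy
    have h := stdGaussian_map_inner (‖y‖⁻¹ • y)
    rw [norm_smul, norm_inv, norm_norm, inv_mul_cancel₀ hy'.ne', one_pow, Real.toNNReal_one] at h
    rw [← h, map_measureReal_apply (by fun_prop) measurableSet_Ici]
    refine measureReal_mono fun z hz => ?_
    simp only [Set.mem_preimage, Set.mem_Ici, real_inner_smul_left, Set.mem_ofPred_eq] at hz ⊢
    rw [inv_mul_eq_div, le_div_iff₀ hy'] at hz
    exact hz

lemma integrable_inner_sq (y : EuclideanSpace ℝ (Fin d)) :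
    Integrable (fun z => inner ℝ y z ^ 2) (stdGaussian (EuclideanSpace ℝ (Fin d))) := by
  have h := IsGaussian.memLp_dual (stdGaussian (EuclideanSpace ℝ (Fin d))) (innerSL ℝ y) 2 (by simp)
  exact h.integrable_sq

lemma integral_inner_sq (y : EuclideanSpace ℝ (Fin d)) :
    ∫ z, inner ℝ y z ^ 2 ∂(stdGaussian (EuclideanSpace ℝ (Fin d))) = ‖y‖ ^ 2 := by
  have h := variance_dual_stdGaussian (innerSL ℝ y)
  rw [variance_of_integral_eq_zero (innerSL ℝ y).continuous.aemeasurable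
    (integral_strongDual_stdGaussian _), innerSL_apply_norm] at h
  exact h

lemma integral_abs_inner_le (y : EuclideanSpace ℝ (Fin d)) :
    ∫ z, |inner ℝ y z| ∂(stdGaussian (EuclideanSpace ℝ (Fin d))) ≤ ‖y‖ := by
  rcases eq_or_ne y 0 with rfl | hy
  · simp
  have hy' : 0 < ‖y‖ := norm_pos_iff.2 hy
  have h1 : ∀ z : EuclideanSpace ℝ (Fin d),
      |inner ℝ y z| ≤ (inner ℝ y z ^ 2 / ‖y‖ + ‖y‖) / 2 := by
    intro z
    rw [le_div_iff₀ two_pos, ← sub_nonneg]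
    have : inner ℝ y z ^ 2 / ‖y‖ + ‖y‖ - |inner ℝ y z| * 2 = (|inner ℝ y z| - ‖y‖) ^ 2 / ‖y‖ := by
      rw [sub_sq, sq_abs]; field_simp
      ring
    rw [this]; positivity
  have hi := integrable_inner_sq y
  calc _ ≤ ∫ z, (inner ℝ y z ^ 2 / ‖y‖ + ‖y‖) / 2 ∂(stdGaussian (EuclideanSpace ℝ (Fin d))) :=
        integral_mono_of_nonneg (ae_of_all _ fun z => abs_nonneg _)
          (((hi.div_const _).add (integrable_const _)).div_const _) (ae_of_all _ h1)
    _ = ‖y‖ := by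
        rw [integral_div, integral_add (hi.div_const _) (integrable_const _), integral_div,
          integral_inner_sq]
        simp
        field_simp
        ring

lemma integrable_norm_sq_stdGaussian :
    Integrable (fun z => ‖z‖ ^ 2) (stdGaussian (EuclideanSpace ℝ (Fin d))) ∧
    ∫ z, ‖z‖ ^ 2 ∂(stdGaussian (EuclideanSpace ℝ (Fin d))) = d := by
  have h : ∀ z : EuclideanSpace ℝ (Fin d),
      ‖z‖ ^ 2 = ∑ i, inner ℝ (EuclideanSpace.basisFun (Fin d) ℝ i) z ^ 2 := fun z =>
    ((EuclideanSpace.basisFun (Fin d) ℝ).sum_sq_inner_right z).symm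
  simp only [h]
  refine ⟨integrable_finsetSum _ fun i _ => integrable_inner_sq _, ?_⟩
  rw [integral_finsetSum _ fun i _ => integrable_inner_sq _]
  simp only [integral_inner_sq, OrthonormalBasis.norm_eq_one]
  simp

lemma integrable_exp_inner_sq {y : EuclideanSpace ℝ (Fin d)} (hy : ‖y‖ = 1 ∨ y = 0) :
    Integrable (fun z => Real.exp (inner ℝ y z ^ 2 / 4))
      (stdGaussian (EuclideanSpace ℝ (Fin d))) ∧
    ∫ z, Real.exp (inner ℝ y z ^ 2 / 4) ∂(stdGaussian (EuclideanSpace ℝ (Fin d))) ≤ √2 := by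
  rcases hy with hy | rfl
  swap
  · simp
  have hmap := stdGaussian_map_inner y
  rw [hy, one_pow, Real.toNNReal_one] at hmap
  have hm : Measurable fun z : EuclideanSpace ℝ (Fin d) => inner ℝ y z := by fun_prop
  have hpdf : ∀ t : ℝ, gaussianPDFReal 0 1 t * Real.exp (t ^ 2 / 4) =
      (√(2 * Real.pi))⁻¹ * Real.exp (-(1 / 4) * t ^ 2) := by
    intro t
    simp only [gaussianPDFReal, NNReal.coe_one, mul_one, sub_zero, mul_assoc, ← Real.exp_add]
    congr 2
    ring
  have hint : ∫ t, Real.exp (t ^ 2 / 4) ∂(gaussianReal 0 1) = √2 := by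
    rw [integral_gaussianReal_eq_integral_smul one_ne_zero]
    simp only [smul_eq_mul, hpdf]
    rw [integral_const_mul, integral_gaussian, inv_mul_eq_div, ← Real.sqrt_div' _ (by positivity)]
    congr 1
    have := Real.pi_pos
    field_simp
    norm_num
  -- A non-integrable function would have integral 0 by convention, but the value just computed is
  -- √2.
  have hI : Integrable (fun t => Real.exp (t ^ 2 / 4)) (gaussianReal 0 1) := by
    by_contra hn
    rw [integral_undef hn] at hint
    have := Real.sqrt_pos.2 (two_pos (α := ℝ))
    linarith
  rw [← hmap] at hint hI
  rw [integral_map hm.aemeasurable (by fun_prop)] at hint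
  exact ⟨hI.comp_measurable hm, hint.le⟩

/-- The largest absolute value of finitely many linear functionals. -/
def maxAbsInner (y : Fin L → EuclideanSpace ℝ (Fin d)) (z : EuclideanSpace ℝ (Fin d)) : ℝ :=
  ⨆ i, |inner ℝ (y i) z|

lemma measurable_maxAbsInner (y : Fin L → EuclideanSpace ℝ (Fin d)) :
    Measurable (maxAbsInner y) := by
  unfold maxAbsInner
  exact Measurable.iSup fun i => by fun_prop

lemma abs_inner_le_maxAbsInner (y : Fin L → EuclideanSpace ℝ (Fin d))
    (z : EuclideanSpace ℝ (Fin d)) (i : Fin L) : |inner ℝ (y i) z| ≤ maxAbsInner y z :=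
  le_ciSup (f := fun i => |inner ℝ (y i) z|) (Set.finite_range _).bddAbove i

lemma maxAbsInner_nonneg (y : Fin L → EuclideanSpace ℝ (Fin d))
    (z : EuclideanSpace ℝ (Fin d)) : 0 ≤ maxAbsInner y z :=
  Real.iSup_nonneg fun _ => abs_nonneg _

/-- The dimension bound is Z² ≤ ‖z‖². The log L bound is the exponential-moment argument for a
maximum; no independence between the functionals is needed. -/
lemma integral_maxAbsInner_sq_le (hL : 2 ≤ L) {y : Fin L → EuclideanSpace ℝ (Fin d)}
    (hy : ∀ i, ‖y i‖ = 1 ∨ y i = 0) :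
    Integrable (fun z => maxAbsInner y z ^ 2) (stdGaussian (EuclideanSpace ℝ (Fin d))) ∧
    ∫ z, maxAbsInner y z ^ 2 ∂(stdGaussian (EuclideanSpace ℝ (Fin d))) ≤
      7 * min (d : ℝ) (Real.log L) := by
  have : Nonempty (Fin L) := ⟨⟨0, by omega⟩⟩
  have hL0 : (0 : ℝ) < L := by positivity
  have hattain : ∀ z, ∃ i, maxAbsInner y z = |inner ℝ (y i) z| := fun z => by
    obtain ⟨i, hi⟩ := exists_eq_ciSup_of_finite (f := fun i => |inner ℝ (y i) z|)
    exact ⟨i, hi.symm⟩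
  have hnorm : ∀ z, maxAbsInner y z ^ 2 ≤ ‖z‖ ^ 2 := by
    intro z
    obtain ⟨i, hi⟩ := hattain z
    rw [hi]
    have h1 := abs_real_inner_le_norm (y i) z
    have h2 : ‖y i‖ ≤ 1 := by rcases hy i with h | h <;> simp [h]
    have h3 : |inner ℝ (y i) z| ≤ ‖z‖ := h1.trans (mul_le_of_le_one_left (norm_nonneg _) h2)
    gcongr
  -- From log u ≤ u - 1 with u = exp(Z²/4)/L. Averaging gives 4(log L - 1 + √2), and 4(√2 - 1) ≤ 3
  -- log 2 ≤ 3 log L leads to the constant 7.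
  have hexp : ∀ z, maxAbsInner y z ^ 2 ≤
      4 * (Real.log L - 1 + (∑ i, Real.exp (inner ℝ (y i) z ^ 2 / 4)) / L) := by
    intro z
    obtain ⟨i, hi⟩ := hattain z
    rw [hi, sq_abs]
    set e := Real.exp (inner ℝ (y i) z ^ 2 / 4) with he
    have h1 : e ≤ ∑ i, Real.exp (inner ℝ (y i) z ^ 2 / 4) :=
      Finset.single_le_sum (f := fun i => Real.exp (inner ℝ (y i) z ^ 2 / 4))
        (fun _ _ => (Real.exp_pos _).le) (Finset.mem_univ i)
    have h2 : Real.log (e / L) ≤ e / L - 1 :=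
      Real.log_le_sub_one_of_pos (div_pos (Real.exp_pos _) hL0)
    rw [Real.log_div (Real.exp_pos _).ne' hL0.ne', he, Real.log_exp, ← he] at h2
    have h3 : e / L ≤ (∑ i, Real.exp (inner ℝ (y i) z ^ 2 / 4)) / L := by gcongr
    linarith
  have hI : Integrable (fun z => maxAbsInner y z ^ 2)
      (stdGaussian (EuclideanSpace ℝ (Fin d))) := by
    refine integrable_norm_sq_stdGaussian.1.mono'
      ((measurable_maxAbsInner y).pow_const 2).aestronglyMeasurable (ae_of_all _ fun z => ?_)
    rw [Real.norm_of_nonneg (sq_nonneg _)]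
    exact hnorm z
  refine ⟨hI, ?_⟩
  rw [mul_min_of_nonneg _ _ (by norm_num)]
  refine le_min ?_ ?_
  · have := integral_mono hI integrable_norm_sq_stdGaussian.1 hnorm
    rw [integrable_norm_sq_stdGaussian.2] at this
    have : (0 : ℝ) ≤ d := by positivity
    linarith
  · have hsum : Integrable (fun z => ∑ i, Real.exp (inner ℝ (y i) z ^ 2 / 4))
        (stdGaussian (EuclideanSpace ℝ (Fin d))) :=
      integrable_finsetSum _ fun i _ => (integrable_exp_inner_sq (hy i)).1
    have h := integral_mono hI
      (((integrable_const (Real.log L - 1)).add (hsum.div_const L)).const_mul 4) hexp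
    refine h.trans ?_
    simp only [Pi.add_apply]
    rw [integral_const_mul, integral_add (integrable_const _) (hsum.div_const _), integral_div,
      integral_finsetSum _ fun i _ => (integrable_exp_inner_sq (hy i)).1, integral_const]
    simp only [probReal_univ, one_smul]
    have h1 : (∑ i, ∫ z, Real.exp (inner ℝ (y i) z ^ 2 / 4)
        ∂(stdGaussian (EuclideanSpace ℝ (Fin d)))) / L ≤ √2 := by
      rw [div_le_iff₀ hL0]
      refine (Finset.sum_le_sum fun i _ => (integrable_exp_inner_sq (hy i)).2).trans ?_
      simp [mul_comm]
    have h2 : √2 ≤ 1.4143 := by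
      rw [Real.sqrt_le_left (by norm_num)]; norm_num
    have h3 : (0.6931471803 : ℝ) < Real.log L := lt_of_lt_of_le Real.log_two_gt_d9
      (Real.log_le_log two_pos (by exact_mod_cast hL))
    linarith

/-! ### Reward of the greedy list under perturbed scores -/

/-- Scores that differ from `w` by a bias along `ε` and by a Gaussian perturbation shaped by `Q`. -/
def noisyScore (w : Fin L → ℝ) (x : Fin L → EuclideanSpace ℝ (Fin d))
    (ε : EuclideanSpace ℝ (Fin d)) (V : ℝ)
    (Q : EuclideanSpace ℝ (Fin d) →ₗ[ℝ] EuclideanSpace ℝ (Fin d))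
    (z : EuclideanSpace ℝ (Fin d)) (i : Fin L) : ℝ :=
  w i + inner ℝ (x i) ε + V * inner ℝ (Q (x i)) z

/-- The vector `v` scaled to length one, or `0`. -/
def unitVec (v : EuclideanSpace ℝ (Fin d)) : EuclideanSpace ℝ (Fin d) := ‖v‖⁻¹ • v

lemma norm_unitVec (v : EuclideanSpace ℝ (Fin d)) : ‖unitVec v‖ = 1 ∨ unitVec v = 0 := by
  rcases eq_or_ne v 0 with rfl | hv
  · right; simp [unitVec]
  · left
    rw [unitVec, norm_smul, norm_inv, norm_norm, inv_mul_cancel₀ (norm_ne_zero_iff.2 hv)]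

lemma inner_eq_norm_mul_inner_unitVec (v z : EuclideanSpace ℝ (Fin d)) :
    inner ℝ v z = ‖v‖ * inner ℝ (unitVec v) z := by
  rcases eq_or_ne v 0 with rfl | hv
  · simp
  · rw [unitVec, real_inner_smul_left, mul_inv_cancel_left₀ (norm_ne_zero_iff.2 hv)]

/-- The confidence widths of the items of a list, weighted by their probabilities of being seen. -/
def listWidth (w : Fin L → ℝ) (p : Fin L → EuclideanSpace ℝ (Fin d)) (S : RecList K L) : ℝ :=
  ∑ k, viewProb (fun k => w (S k)) k * ‖p (S k)‖

lemma listWidth_nonneg {w : Fin L → ℝ} (hw : ∀ i, w i ∈ Set.Icc (0 : ℝ) 1)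
    (p : Fin L → EuclideanSpace ℝ (Fin d)) (S : RecList K L) : 0 ≤ listWidth w p S :=
  Finset.sum_nonneg fun k _ => mul_nonneg (viewProb_nonneg (fun k => hw (S k)) k) (norm_nonneg _)

/-- Cauchy–Schwarz over the K positions; the square of a probability is at most the probability. -/
lemma listWidth_sq_le {w : Fin L → ℝ} (hw : ∀ i, w i ∈ Set.Icc (0 : ℝ) 1)
    (p : Fin L → EuclideanSpace ℝ (Fin d)) (S : RecList K L) :
    listWidth w p S ^ 2 ≤ K * ∑ k, viewProb (fun k => w (S k)) k * ‖p (S k)‖ ^ 2 := by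
  have h := sq_sum_le_card_mul_sum_sq (s := Finset.univ)
    (f := fun k => viewProb (fun k => w (S k)) k * ‖p (S k)‖)
  rw [Finset.card_univ, Fintype.card_fin] at h
  refine h.trans ?_
  gcongr with k _
  have h0 := viewProb_nonneg (fun k => hw (S k)) k
  have h1 := viewProb_le_one (fun k => hw (S k)) k
  rw [mul_pow]
  gcongr
  nlinarith

section Noisy

variable {w : Fin L → ℝ} {x : Fin L → EuclideanSpace ℝ (Fin d)} {ε : EuclideanSpace ℝ (Fin d)}
  {V G : ℝ} {Q : EuclideanSpace ℝ (Fin d) →ₗ[ℝ] EuclideanSpace ℝ (Fin d)}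

lemma measurable_noisyScore (i : Fin L) : Measurable fun z => noisyScore w x ε V Q z i := by
  unfold noisyScore
  fun_prop

lemma measurable_reward_clip_noisyScore (S : RecList K L) :
    Measurable fun z => reward (clip (noisyScore w x ε V Q z)) S := by
  have h : ∀ i, Measurable fun z => clip (noisyScore w x ε V Q z) i := fun i =>
    measurable_const.max ((measurable_noisyScore i).min measurable_const)
  unfold reward
  exact measurable_const.sub (Finset.measurable_prod _ fun k _ => measurable_const.sub (h (S k)))

lemma measurable_optReward_clip_noisyScore :
    Measurable fun z => optReward K (clip (noisyScore w x ε V Q z)) := by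
  unfold optReward
  exact Measurable.iSup measurable_reward_clip_noisyScore

lemma integrable_of_mem_Icc {α : Type*} [MeasurableSpace α] {μ : Measure α} [IsFiniteMeasure μ]
    {f : α → ℝ} (hm : AEStronglyMeasurable f μ) (h : ∀ a, f a ∈ Set.Icc (0 : ℝ) 1) :
    Integrable f μ :=
  Integrable.of_bound hm 1 (ae_of_all _ fun a => by
    rw [Real.norm_of_nonneg (h a).1]; exact (h a).2)

variable (hw : ∀ i, w i ∈ Set.Icc (0 : ℝ) 1) (hV : 0 ≤ V)
  (hε : ∀ y, |inner ℝ y ε| ≤ G * V * ‖Q y‖)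

include hε hV in
lemma abs_noisyScore_sub_le (z : EuclideanSpace ℝ (Fin d)) (i : Fin L) :
    |noisyScore w x ε V Q z i - w i| ≤
      V * ‖Q (x i)‖ * (G + |inner ℝ (unitVec (Q (x i))) z|) := by
  have e : noisyScore w x ε V Q z i - w i =
      inner ℝ (x i) ε + V * inner ℝ (Q (x i)) z := by unfold noisyScore; ring
  rw [e, inner_eq_norm_mul_inner_unitVec (Q (x i)) z]
  refine (abs_add_le _ _).trans ((add_le_add_left (hε (x i)) _).trans (le_of_eq ?_))
  rw [abs_mul, abs_mul, abs_of_nonneg hV, abs_of_nonneg (norm_nonneg _)]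
  ring

include hε hV hw in
-- Along the functional of `exists_optimism_functional` for an optimal list, the score error is ⟨y,
-- ε⟩ + V⟨Qy, z⟩ for a single vector y, and `hε` bounds the bias by GV‖Qy‖. So the half-space ⟨Qy,
-- z⟩ ≥ G‖Qy‖ consists of optimistic samples.
lemma optimism_prob_le [Nonempty (RecList K L)] {c : ℝ}
    (hc : ∀ y : EuclideanSpace ℝ (Fin d), c ≤
      (stdGaussian (EuclideanSpace ℝ (Fin d))).real {z | G * ‖y‖ ≤ inner ℝ y z}) :
    c ≤ (stdGaussian (EuclideanSpace ℝ (Fin d))).real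
      {z | optReward K w ≤ optReward K (clip (noisyScore w x ε V Q z))} := by
  obtain ⟨S, hS⟩ := exists_reward_eq_optReward (K := K) w
  obtain ⟨a, ha⟩ := exists_optimism_functional hw S
  refine (hc (Q (∑ k, a k • x (S k)))).trans (measureReal_mono fun z hz => ?_)
  simp only [Set.mem_ofPred_eq] at hz ⊢
  rw [← hS]
  refine (ha _ ?_).trans (reward_le_optReward _ S)
  have e : ∑ k, a k * (noisyScore w x ε V Q z (S k) - w (S k)) =
      inner ℝ (∑ k, a k • x (S k)) ε + V * inner ℝ (Q (∑ k, a k • x (S k))) z := by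
    simp only [noisyScore, map_sum, map_smul, sum_inner, real_inner_smul_left, Finset.mul_sum,
      ← Finset.sum_add_distrib]
    exact Finset.sum_congr rfl fun k _ => by ring
  rw [e]
  have h1 := neg_le_of_abs_le (hε (∑ k, a k • x (S k)))
  have h2 := mul_le_mul_of_nonneg_left hz hV
  linarith

include hε hV hw in
/-- The shortfall of the mean optimistic value is controlled by its fluctuations. -/
lemma optReward_sub_integral_le [Nonempty (RecList K L)] {c : ℝ} (hc0 : 0 < c)
    (hc : ∀ y : EuclideanSpace ℝ (Fin d), c ≤
      (stdGaussian (EuclideanSpace ℝ (Fin d))).real {z | G * ‖y‖ ≤ inner ℝ y z}) (m : ℝ) :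
    optReward K w - m ≤ c⁻¹ * ∫ z, max (optReward K (clip (noisyScore w x ε V Q z)) - m) 0
        ∂(stdGaussian (EuclideanSpace ℝ (Fin d))) := by
  set γ := stdGaussian (EuclideanSpace ℝ (Fin d))
  have hO := optimism_prob_le (K := K) (x := x) hw hV hε hc
  set O := {z | optReward K w ≤ optReward K (clip (noisyScore w x ε V Q z))}
  have hOm : MeasurableSet O :=
    measurableSet_le measurable_const measurable_optReward_clip_noisyScore
  rw [inv_mul_eq_div, le_div_iff₀ hc0]
  rcases le_total (optReward K w) m with h | h
  · refine le_trans ?_ (integral_nonneg fun z => le_max_right _ _)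
    exact mul_nonpos_of_nonpos_of_nonneg (by linarith) hc0.le
  · have hI : Integrable (fun z => max (optReward K (clip (noisyScore w x ε V Q z)) - m) 0) γ :=
      ((integrable_of_mem_Icc measurable_optReward_clip_noisyScore.aestronglyMeasurable
        fun z => optReward_mem (clip_mem _)).sub (integrable_const m)).pos_part
    -- On the optimistic event the positive part is at least `optReward K w - m`.
    calc (optReward K w - m) * c ≤ γ.real O * (optReward K w - m) := by
          rw [mul_comm]; gcongr
      _ = ∫ z, O.indicator (fun _ => optReward K w - m) z ∂γ := by
          rw [integral_indicator_const _ hOm, smul_eq_mul]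
      _ ≤ _ := by
          refine integral_mono ((integrable_const _).indicator hOm) hI fun z => ?_
          by_cases hz : z ∈ O
          · rw [Set.indicator_of_mem hz]
            have : optReward K w ≤ optReward K (clip (noisyScore w x ε V Q z)) := hz
            exact le_max_of_le_left (by linarith)
          · rw [Set.indicator_of_notMem hz]
            exact le_max_right _ _

include hε hV hw in
-- The maximum over all items makes the bound valid for a list chosen in view of `z`.
lemma reward_clip_sub_reward_le (z : EuclideanSpace ℝ (Fin d)) (S : RecList K L) :
    |reward (clip (noisyScore w x ε V Q z)) S - reward w S| ≤
      V * listWidth w (fun i => Q (x i)) S *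
        (G + maxAbsInner (fun i => unitVec (Q (x i))) z) := by
  refine (abs_reward_sub_reward_le (clip_mem _) hw S).trans ?_
  unfold listWidth
  rw [Finset.mul_sum, Finset.sum_mul]
  refine Finset.sum_le_sum fun k _ => ?_
  have h0 := viewProb_nonneg (fun k => hw (S k)) k
  have h1 := (abs_clip_sub_le (noisyScore w x ε V Q z) (S k) (hw (S k))).trans
    (abs_noisyScore_sub_le hV hε z (S k))
  have h2 := abs_inner_le_maxAbsInner (fun i => unitVec (Q (x i))) z (S k)
  calc _ ≤ viewProb (fun k => w (S k)) k * (V * ‖Q (x (S k))‖ *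
        (G + maxAbsInner (fun i => unitVec (Q (x i))) z)) := by
        gcongr
        exact h1.trans (by gcongr)
    _ = _ := by ring

include hε hV hw in
-- For a list that does not vary with `z` each normalized functional can be averaged separately, so
-- no maximum enters.
lemma integral_abs_reward_clip_sub_reward_le (S : RecList K L) :
    ∫ z, |reward (clip (noisyScore w x ε V Q z)) S - reward w S|
        ∂(stdGaussian (EuclideanSpace ℝ (Fin d))) ≤
      V * listWidth w (fun i => Q (x i)) S * (G + 1) := by
  set γ := stdGaussian (EuclideanSpace ℝ (Fin d))
  have hI : ∀ k : Fin K, Integrable (fun z => |inner ℝ (unitVec (Q (x (S k)))) z|) γ := fun k =>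
    (IsGaussian.integrable_dual γ (innerSL ℝ (unitVec (Q (x (S k)))))).abs
  have hI' : ∀ k : Fin K, Integrable (fun z => viewProb (fun k => w (S k)) k *
      (V * ‖Q (x (S k))‖ * (G + |inner ℝ (unitVec (Q (x (S k)))) z|))) γ := fun k =>
    (((integrable_const G).add (hI k)).const_mul _).const_mul _
  calc _ ≤ ∫ z, ∑ k, viewProb (fun k => w (S k)) k *
        (V * ‖Q (x (S k))‖ * (G + |inner ℝ (unitVec (Q (x (S k)))) z|)) ∂γ := by
        refine integral_mono_of_nonneg (ae_of_all _ fun z => abs_nonneg _)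
          (integrable_finsetSum _ fun k _ => hI' k) (ae_of_all _ fun z => ?_)
        refine (abs_reward_sub_reward_le (clip_mem _) hw S).trans
          (Finset.sum_le_sum fun k _ => ?_)
        have h0 := viewProb_nonneg (fun k => hw (S k)) k
        gcongr
        exact (abs_clip_sub_le (noisyScore w x ε V Q z) (S k) (hw (S k))).trans
          (abs_noisyScore_sub_le hV hε z (S k))
    _ ≤ _ := by
        rw [integral_finsetSum _ fun k _ => hI' k, listWidth, Finset.mul_sum, Finset.sum_mul]
        refine Finset.sum_le_sum fun k _ => ?_
        rw [integral_const_mul, integral_const_mul, integral_add (integrable_const _) (hI k),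
          integral_const, probReal_univ, one_smul]
        have h0 := viewProb_nonneg (fun k => hw (S k)) k
        have h1 : ∫ z, |inner ℝ (unitVec (Q (x (S k)))) z| ∂γ ≤ 1 := by
          refine (integral_abs_inner_le _).trans ?_
          rcases norm_unitVec (Q (x (S k))) with h | h <;> simp [h]
        calc _ ≤ viewProb (fun k => w (S k)) k * (V * ‖Q (x (S k))‖ * (G + 1)) := by gcongr
          _ = _ := by ring

include hε hV hw in
/-- The excess of the optimistic value over its mean is controlled by the width of the list. -/
lemma optReward_clip_sub_integral_le {z : EuclideanSpace ℝ (Fin d)} {S : RecList K L}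
    (hG : 0 ≤ G) (hS : IsGreedy (noisyScore w x ε V Q z) S) :
    max (optReward K (clip (noisyScore w x ε V Q z)) -
      ∫ z, optReward K (clip (noisyScore w x ε V Q z))
        ∂(stdGaussian (EuclideanSpace ℝ (Fin d)))) 0 ≤
      V * listWidth w (fun i => Q (x i)) S *
        (2 * G + 1 + maxAbsInner (fun i => unitVec (Q (x i))) z) := by
  set γ := stdGaussian (EuclideanSpace ℝ (Fin d))
  have : Nonempty (RecList K L) := ⟨S⟩
  have hA := listWidth_nonneg hw (fun i => Q (x i)) S
  have hZ := maxAbsInner_nonneg (fun i => unitVec (Q (x i))) z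
  refine max_le ?_ (by positivity)
  rw [hS.optReward_clip_eq]
  have hI : Integrable (fun z => optReward K (clip (noisyScore w x ε V Q z))) γ :=
    integrable_of_mem_Icc measurable_optReward_clip_noisyScore.aestronglyMeasurable
      fun z => optReward_mem (clip_mem _)
  have hI2 : Integrable (fun z => reward (clip (noisyScore w x ε V Q z)) S) γ :=
    integrable_of_mem_Icc (measurable_reward_clip_noisyScore S).aestronglyMeasurable
      fun z => reward_mem (clip_mem _) S
  -- The list is frozen while the Gaussian is resampled, which only lowers the mean. Both values are
  -- then compared with `reward w S`: the mean costs G + 1, the sample G plus the maximum.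
  have h1 : ∫ z, reward (clip (noisyScore w x ε V Q z)) S ∂γ ≤
      ∫ z, optReward K (clip (noisyScore w x ε V Q z)) ∂γ :=
    integral_mono hI2 hI fun z => reward_le_optReward _ S
  have h2 : reward w S - ∫ z, reward (clip (noisyScore w x ε V Q z)) S ∂γ ≤
      V * listWidth w (fun i => Q (x i)) S * (G + 1) := by
    refine le_trans ?_ (integral_abs_reward_clip_sub_reward_le hw hV hε S)
    have h3 : reward w S - ∫ z, reward (clip (noisyScore w x ε V Q z)) S ∂γ =
        -∫ z, (reward (clip (noisyScore w x ε V Q z)) S - reward w S) ∂γ := by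
      rw [integral_sub hI2 (integrable_const _)]; simp
    rw [h3]
    exact (neg_le_abs _).trans abs_integral_le_integral_abs
  have h4 := le_of_abs_le (reward_clip_sub_reward_le (x := x) hw hV hε z S)
  nlinarith

end Noisy

/-! ### Ridge regression along a realized run -/

section Deterministic

variable (x : Fin L → EuclideanSpace ℝ (Fin d)) (S : ℕ → RecList K L) (W : ℕ → Fin L → Bool)

/-- The accumulated noise `∑ (W(i) - w(i)) x(i)` over the observed items. -/
def noise (w : Fin L → ℝ) : ℕ → Fin d → ℝ
  | 0 => 0
  | n + 1 => noise w n + ∑ k ∈ observed (S n) (W n),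
      ((if W n (S n k) = true then 1 else 0) - w (S n k)) • (x (S n k)).ofLp

/-- This congruence and the next two express that the state of a round depends only on earlier lists
and attractions. -/
lemma gram_congr {S' : ℕ → RecList K L} {W' : ℕ → Fin L → Bool} {n : ℕ}
    (h : ∀ m < n, S m = S' m ∧ W m = W' m) : gram x S W n = gram x S' W' n := by
  induction n with
  | zero => rfl
  | succ n ih =>
    have h' := h n (Nat.lt_succ_self n)
    rw [gram, gram, ih fun m hm => h m (hm.trans (Nat.lt_succ_self n)), h'.1, h'.2]

lemma bvec_congr {S' : ℕ → RecList K L} {W' : ℕ → Fin L → Bool} {n : ℕ}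
    (h : ∀ m < n, S m = S' m ∧ W m = W' m) : bvec x S W n = bvec x S' W' n := by
  induction n with
  | zero => rfl
  | succ n ih =>
    have h' := h n (Nat.lt_succ_self n)
    rw [bvec, bvec, ih fun m hm => h m (hm.trans (Nat.lt_succ_self n)), h'.1, h'.2]

lemma noise_congr {S' : ℕ → RecList K L} {W' : ℕ → Fin L → Bool} {w : Fin L → ℝ} {n : ℕ}
    (h : ∀ m < n, S m = S' m ∧ W m = W' m) : noise x S W w n = noise x S' W' w n := by
  induction n with
  | zero => rfl
  | succ n ih =>
    have h' := h n (Nat.lt_succ_self n)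
    rw [noise, noise, ih fun m hm => h m (hm.trans (Nat.lt_succ_self n)), h'.1, h'.2]

lemma isDesign_gram (n : ℕ) : IsDesign (gram x S W n) := by
  induction n with
  | zero => exact isDesign_one
  | succ n ih => exact ih.add_sum _ _

variable {x}

lemma dotProduct_self_le (hx : ∀ i, ‖x i‖ ≤ 1 / √(K : ℝ)) (i : Fin L) :
    (x i).ofLp ⬝ᵥ (x i).ofLp ≤ 1 / K := by
  rw [← inner_eq_dotProduct, real_inner_self_eq_norm_sq]
  calc ‖x i‖ ^ 2 ≤ ((1 : ℝ) / √(K : ℝ)) ^ 2 := by gcongr; exact hx i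
    _ = (1 / K : ℝ) := by rw [div_pow, one_pow, Real.sq_sqrt (by positivity)]

lemma card_observed_mul_le (S : RecList K L) (W : Fin L → Bool) :
    ((observed S W).card : ℝ) * (1 / K) ≤ 1 := by
  rw [mul_one_div]
  refine div_le_one_of_le₀ ?_ (by positivity)
  have := Finset.card_le_univ (observed S W)
  rw [Fintype.card_fin] at this
  exact_mod_cast this

/-- A round adds at most K rank-one terms, each of norm at most 1/K. -/
lemma gram_form_le (hx : ∀ i, ‖x i‖ ≤ 1 / √(K : ℝ)) (n : ℕ) (y : Fin d → ℝ) :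
    y ⬝ᵥ (gram x S W n *ᵥ y) ≤ (n + 1) * (y ⬝ᵥ y) := by
  have hy : 0 ≤ y ⬝ᵥ y := by simpa using dotProduct_star_self_nonneg y
  induction n with
  | zero => simp [gram]
  | succ n ih =>
    rw [gram, add_mulVec, dotProduct_add, sum_mulVec, dotProduct_sum]
    have h1 : ∀ k, y ⬝ᵥ (vecMulVec (x (S n k)).ofLp (x (S n k)).ofLp *ᵥ y) ≤
        1 / K * (y ⬝ᵥ y) := by
      intro k
      have hc := real_inner_mul_inner_self_le (WithLp.toLp 2 y) (x (S n k))
      simp only [inner_eq_dotProduct] at hc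
      have h2 := mul_le_mul_of_nonneg_right (dotProduct_self_le (K := K) hx (S n k)) hy
      rw [vecMulVec_mulVec, op_smul_eq_smul, dotProduct_smul, smul_eq_mul,
        dotProduct_comm _ y]
      linarith
    have h3 := Finset.sum_le_sum fun k (_ : k ∈ observed (S n) (W n)) => h1 k
    rw [Finset.sum_const, nsmul_eq_mul, ← mul_assoc] at h3
    have h4 := mul_le_mul_of_nonneg_right (card_observed_mul_le (S n) (W n)) hy
    push_cast
    linarith

lemma det_gram_le (hx : ∀ i, ‖x i‖ ≤ 1 / √(K : ℝ)) (n : ℕ) :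
    (gram x S W n).det ≤ ((n : ℝ) + 1) ^ d :=
  det_le_pow_of_form_le (isDesign_gram x S W n).posDef (gram_form_le S W hx n)

variable (x) in
lemma bvec_eq_noise (β : EuclideanSpace ℝ (Fin d)) (n : ℕ) :
    (bvec x S W n).ofLp = noise x S W (weight x β) n + gram x S W n *ᵥ β.ofLp - β.ofLp := by
  induction n with
  | zero => simp [bvec, noise, gram]
  | succ n ih =>
    have h : ∀ k, vecMulVec (x (S n k)).ofLp (x (S n k)).ofLp *ᵥ β.ofLp =
        weight x β (S n k) • (x (S n k)).ofLp := by
      intro k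
      rw [vecMulVec_mulVec, op_smul_eq_smul, weight, inner_eq_dotProduct]
    rw [bvec, noise, gram, WithLp.ofLp_add, ih, WithLp.ofLp_sum, add_mulVec, sum_mulVec]
    simp only [WithLp.ofLp_smul, h, sub_smul, Finset.sum_sub_distrib]
    abel

/-- The second term is the bias of the ridge regularizer, the identity in M. -/
lemma inner_psiHat_sub (β y : EuclideanSpace ℝ (Fin d)) (n : ℕ) :
    inner ℝ y (psiHat x S W n - β) =
      invForm (gram x S W n) y.ofLp (noise x S W (weight x β) n) -
        invForm (gram x S W n) y.ofLp β.ofLp := by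
  have hu : IsUnit (gram x S W n).det :=
    (isUnit_iff_isUnit_det _).1 (isDesign_gram x S W n).posDef.isUnit
  rw [inner_eq_dotProduct, WithLp.ofLp_sub, psiHat, ofLp_toEuclideanLin, bvec_eq_noise x S W β,
    mulVec_sub, mulVec_add, mulVec_mulVec, nonsing_inv_mul _ hu, one_mulVec]
  simp only [invForm, dotProduct_sub, dotProduct_add]
  ring

/-- The elliptical potential inequality for a whole run. -/
lemma sum_invForm_observed_le (hK : 1 ≤ K) (hx : ∀ i, ‖x i‖ ≤ 1 / √(K : ℝ)) (T : ℕ) :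
    ∑ n ∈ Finset.range T, ∑ k ∈ observed (S n) (W n),
      invForm (gram x S W n) (x (S n k)).ofLp (x (S n k)).ofLp ≤
        2 * Real.exp 1 * (d * Real.log (T + 1)) := by
  have h : Real.exp (-1) / 2 * ∑ n ∈ Finset.range T, ∑ k ∈ observed (S n) (W n),
      invForm (gram x S W n) (x (S n k)).ofLp (x (S n k)).ofLp ≤
        Real.log (gram x S W T).det := by
    induction T with
    | zero => simp [gram]
    | succ T ih =>
      have h1 := (isDesign_gram x S W T).sum_invForm_le_log_det (r := 1 / (K : ℝ))
        (div_le_one_of_le₀ (by exact_mod_cast hK) (by positivity)) (observed (S T) (W T))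
        (card_observed_mul_le _ _) (fun k => (x (S T k)).ofLp)
        (fun k => dotProduct_self_le hx (S T k))
      rw [Finset.sum_range_succ, mul_add, gram]
      linarith
  have h2 : Real.log (gram x S W T).det ≤ d * Real.log (T + 1) := by
    rw [← Real.log_pow]
    exact Real.log_le_log (isDesign_gram x S W T).posDef.det_pos (det_gram_le S W hx T)
  have h3 := h.trans h2
  rw [Real.exp_neg, inv_eq_one_div, div_div, one_div, inv_mul_eq_div,
    div_le_iff₀ (by positivity)] at h3
  linarith

/-- Where the deviation potential is small, the estimate is accurate in all directions. -/
lemma abs_inner_psiHat_sub_le (hd : 1 ≤ d) (hx : ∀ i, ‖x i‖ ≤ 1 / √(K : ℝ))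
    (β y : EuclideanSpace ℝ (Fin d)) (n : ℕ)
    (h : devPotential (gram x S W n) (noise x S W (weight x β) n) ≤ n + 1) :
    |inner ℝ y (psiHat x S W n - β)| ≤
      (√(2 * (d * Real.log (n + 1))) + ‖β‖) *
        ‖Matrix.toEuclideanLin (invSqrt (gram x S W n)) y‖ := by
  have hD := isDesign_gram x S W n
  have hdet := det_gram_le S W hx n
  rw [inner_psiHat_sub]
  set M := gram x S W n
  set s := noise x S W (weight x β) n
  have hn : ∀ v : EuclideanSpace ℝ (Fin d),
      √(invForm M v.ofLp v.ofLp) = ‖Matrix.toEuclideanLin (invSqrt M) v‖ := fun v => by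
    rw [← norm_sq_toEuclideanLin_invSqrt hD.posDef, Real.sqrt_sq (norm_nonneg _)]
  have hβ : √(invForm M β.ofLp β.ofLp) ≤ ‖β‖ := by
    refine Real.sqrt_le_iff.2 ⟨norm_nonneg _, (hD.invForm_self_le _).trans (le_of_eq ?_)⟩
    rw [← inner_eq_dotProduct, real_inner_self_eq_norm_sq]
  have hs : √(invForm M s s) ≤ √(2 * (d * Real.log (n + 1))) := by
    refine Real.sqrt_le_sqrt ?_
    have hn0 : (0 : ℝ) < n + 1 := by positivity
    rw [devPotential, div_le_iff₀ hD.posDef.det_pos] at h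
    -- One factor n+1 is the threshold of the event and d factors come from the determinant; d + 1 ≤
    -- 2d explains the 2 in the radius.
    have h1 : Real.exp (invForm M s s) ≤ ((n : ℝ) + 1) ^ (d + 1) := by
      rw [pow_succ']
      exact h.trans (by gcongr)
    rw [← Real.le_log_iff_exp_le (by positivity), Real.log_pow] at h1
    have hl : 0 ≤ Real.log ((n : ℝ) + 1) := Real.log_nonneg (by linarith [n.cast_nonneg (α := ℝ)])
    have hd' : (1 : ℝ) ≤ d := by exact_mod_cast hd
    push_cast at h1
    nlinarith
  have h1 := abs_invForm_le hD.posDef y.ofLp s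
  have h2 := abs_invForm_le hD.posDef y.ofLp β.ofLp
  rw [hn y] at h1 h2
  refine (abs_sub _ _).trans ?_
  rw [add_mul]
  refine add_le_add (h1.trans ?_) (h2.trans ?_)
  · rw [mul_comm]; gcongr
  · rw [mul_comm]; gcongr

end Deterministic

/-! ### Averaging given a finite-valued past -/

section Independence

variable {Ω α β : Type*} [MeasurableSpace Ω] {μ : Measure Ω} [IsProbabilityMeasure μ]
  [MeasurableSpace α] [Finite α] [MeasurableSingletonClass α] [MeasurableSpace β]

omit [IsProbabilityMeasure μ] in
lemma measurable_of_factors {X : Ω → α} (hX : Measurable X) {f : Ω → ℝ}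
    (hf : ∀ ω ω', X ω = X ω' → f ω = f ω') : Measurable f := by
  have h : Function.FactorsThrough f X := fun ω ω' => hf ω ω'
  rw [← h.extend_comp (fun _ => (0 : ℝ))]
  exact (Measurable.of_discrete (f := Function.extend X f fun _ => (0 : ℝ))).comp hX

/-- Since `X` takes finitely many values, f splits into indicators of `X` times functions of `Y`,
and independence applies termwise. Past Gaussian vectors influence the state only through lists and
attractions, so a finite-valued `X` suffices. -/
lemma integral_of_indepFun_finite {X : Ω → α} {Y : Ω → β} (hX : Measurable X) (hY : Measurable Y)
    (hXY : IndepFun Y X μ) {f : Ω → β → ℝ} (hf : ∀ ω ω', X ω = X ω' → f ω = f ω')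
    (hm : ∀ ω, Measurable (f ω)) (hi : ∀ ω, Integrable (f ω) (μ.map Y)) :
    Integrable (fun ω => f ω (Y ω)) μ ∧
      ∫ ω, f ω (Y ω) ∂μ = ∫ ω, ∫ z, f ω z ∂(μ.map Y) ∂μ := by
  classical
  have := Fintype.ofFinite α
  have hfac : Function.FactorsThrough f X := fun ω ω' => hf ω ω'
  set g : α → β → ℝ := Function.extend X f (0 : α → β → ℝ)
  have hg : ∀ ω, g (X ω) = f ω := fun ω => hfac.extend_apply _ ω
  have hg0 : ∀ a, (¬ ∃ ω, X ω = a) → g a = 0 := fun a h => Function.extend_apply' f (0 : α → β → ℝ) a h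
  have hgm : ∀ a, Measurable (g a) := fun a => by
    by_cases h : ∃ ω, X ω = a
    · obtain ⟨ω, rfl⟩ := h
      rw [hg]; exact hm ω
    · rw [hg0 a h]; exact measurable_const
  have hgi : ∀ a, Integrable (g a) (μ.map Y) := fun a => by
    by_cases h : ∃ ω, X ω = a
    · obtain ⟨ω, rfl⟩ := h
      rw [hg]; exact hi ω
    · rw [hg0 a h]; exact integrable_zero _ _ _
  set ind : α → α → ℝ := fun a b => if b = a then 1 else 0
  have hind : ∀ a, Measurable (ind a) := fun a => Measurable.of_discrete
  have hindI : ∀ a, Integrable (fun ω => ind a (X ω)) μ := fun a =>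
    integrable_of_mem_Icc ((hind a).comp hX).aestronglyMeasurable fun ω => by
      simp only [ind]; split_ifs <;> simp
  have hsum : ∀ (c : α → ℝ) ω, c (X ω) = ∑ a, ind a (X ω) * c a := fun c ω => by simp [ind]
  have hindep : ∀ a, IndepFun (fun ω => ind a (X ω)) (fun ω => g a (Y ω)) μ := fun a =>
    hXY.symm.comp (hind a) (hgm a)
  have hgY : ∀ a, Integrable (fun ω => g a (Y ω)) μ := fun a => (hgi a).comp_measurable hY
  have hprod : ∀ a, Integrable (fun ω => ind a (X ω) * g a (Y ω)) μ := fun a =>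
    (hindep a).integrable_mul (hindI a) (hgY a)
  have e1 : (fun ω => f ω (Y ω)) = fun ω => ∑ a, ind a (X ω) * g a (Y ω) := by
    funext ω
    rw [← hg ω]
    exact hsum (fun a => g a (Y ω)) ω
  have e2 : (fun ω => ∫ z, f ω z ∂(μ.map Y)) =
      fun ω => ∑ a, ind a (X ω) * ∫ z, g a z ∂(μ.map Y) := by
    funext ω
    rw [← hg ω]
    exact hsum (fun a => ∫ z, g a z ∂(μ.map Y)) ω
  rw [e1, e2]
  refine ⟨integrable_finsetSum _ fun a _ => hprod a, ?_⟩
  rw [integral_finsetSum _ fun a _ => hprod a,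
    integral_finsetSum _ fun a _ => (hindI a).mul_const _]
  refine Finset.sum_congr rfl fun a _ => ?_
  rw [integral_mul_const, integral_map hY.aemeasurable (hgm a).aestronglyMeasurable]
  exact (hindep a).integral_fun_mul_eq_mul_integral ((hind a).comp hX).aestronglyMeasurable
    ((hgm a).comp hY).aestronglyMeasurable

end Independence

lemma exists_bound_of_factors {Ω α : Type*} [Finite α] {X : Ω → α} {f : Ω → ℝ}
    (hf : ∀ ω ω', X ω = X ω' → f ω = f ω') : ∃ C, ∀ ω, ‖f ω‖ ≤ C := by
  have h : Function.FactorsThrough f X := fun ω ω' => hf ω ω'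
  obtain ⟨C, hC⟩ := (Set.finite_range fun a => ‖Function.extend X f (fun _ => (0 : ℝ)) a‖).bddAbove
  refine ⟨C, fun ω => ?_⟩
  rw [← h.extend_apply (fun _ => (0 : ℝ)) ω]
  exact hC ⟨X ω, rfl⟩

lemma integrable_of_factors {Ω α : Type*} [MeasurableSpace Ω] {μ : Measure Ω}
    [IsProbabilityMeasure μ] [MeasurableSpace α] [Finite α] [MeasurableSingletonClass α]
    {X : Ω → α} (hX : Measurable X) {f : Ω → ℝ} (hf : ∀ ω ω', X ω = X ω' → f ω = f ω') :
    Integrable f μ := by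
  obtain ⟨C, hC⟩ := exists_bound_of_factors hf
  exact Integrable.of_bound (measurable_of_factors hX hf).aestronglyMeasurable C (ae_of_all _ hC)

/-! ### Accuracy and total width of a run -/

/-- The lists and attractions before round `n`. -/
def past {Ω : Type*} (S : ℕ → Ω → RecList K L) (W : ℕ → Ω → Fin L → Bool) (n : ℕ) (ω : Ω) :
    Fin n → (Fin K → Fin L) × (Fin L → Bool) := fun m => (⇑(S m ω), W m ω)

lemma eq_of_past_eq {Ω : Type*} {S : ℕ → Ω → RecList K L} {W : ℕ → Ω → Fin L → Bool} {n : ℕ}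
    {ω ω' : Ω} (h : past S W n ω = past S W n ω') :
    ∀ m < n, S m ω = S m ω' ∧ W m ω = W m ω' := fun m hm => by
  have := congrFun h ⟨m, hm⟩
  simp only [past, Prod.mk.injEq] at this
  exact ⟨DFunLike.coe_injective this.1, this.2⟩

/-- The event that the estimate is accurate at the start of round `n`. -/
def accurate {Ω : Type*} (x : Fin L → EuclideanSpace ℝ (Fin d)) (β : EuclideanSpace ℝ (Fin d))
    (S : ℕ → Ω → RecList K L) (W : ℕ → Ω → Fin L → Bool) (n : ℕ) : Set Ω :=
  {ω | devPotential (gram x (fun m => S m ω) (fun m => W m ω) n)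
    (noise x (fun m => S m ω) (fun m => W m ω) (weight x β) n) ≤ n + 1}

lemma mem_accurate_congr {Ω : Type*} {x : Fin L → EuclideanSpace ℝ (Fin d)}
    {β : EuclideanSpace ℝ (Fin d)} {S : ℕ → Ω → RecList K L} {W : ℕ → Ω → Fin L → Bool} {n : ℕ}
    {ω ω' : Ω} (hP : ∀ m < n, S m ω = S m ω' ∧ W m ω = W m ω') :
    ω ∈ accurate x β S W n ↔ ω' ∈ accurate x β S W n := by
  simp only [accurate, Set.mem_ofPred_eq, gram_congr x _ _ hP, noise_congr x _ _ hP]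

namespace IsLinTSCascadeRun

variable {Ω : Type*} [MeasurableSpace Ω] {μ : Measure Ω} [IsProbabilityMeasure μ] {lam : ℝ}
  {x : Fin L → EuclideanSpace ℝ (Fin d)} {β : EuclideanSpace ℝ (Fin d)}
  {ξ : ℕ → Ω → EuclideanSpace ℝ (Fin d)} {S : ℕ → Ω → RecList K L}
  {W : ℕ → Ω → Fin L → Bool} (h : IsLinTSCascadeRun μ lam x β ξ S W)

include h

omit [IsProbabilityMeasure μ] in
lemma measurable_coe_list (n : ℕ) : Measurable fun ω => (⇑(S n ω) : Fin K → Fin L) :=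
  measurable_pi_iff.2 fun k => h.measurable_list n k

omit [IsProbabilityMeasure μ] in
lemma measurable_past (n : ℕ) : Measurable (past S W n) :=
  measurable_pi_iff.2 fun m => (h.measurable_coe_list m).prodMk (h.measurable_attr m)

omit [IsProbabilityMeasure μ] in
lemma indepFun_gauss_past (n : ℕ) : IndepFun (ξ n) (past S W n) μ := by
  have hψ : Measurable fun (v : Fin n → EuclideanSpace ℝ (Fin d) × (Fin K → Fin L) ×
      (Fin L → Bool)) m => (v m).2 := measurable_pi_iff.2 fun m => (measurable_pi_apply m).snd
  exact (h.indep_gauss n).comp measurable_id hψ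

omit [IsProbabilityMeasure μ] in
lemma indepFun_attr_past (n : ℕ) :
    IndepFun (W n) (fun ω => (past S W n ω, (⇑(S n ω) : Fin K → Fin L))) μ := by
  have hψ : Measurable fun v : (Fin n → EuclideanSpace ℝ (Fin d) × (Fin K → Fin L) ×
      (Fin L → Bool)) × EuclideanSpace ℝ (Fin d) × (Fin K → Fin L) =>
      ((fun m => (v.1 m).2), v.2.2) :=
    (measurable_pi_iff.2 fun m => ((measurable_pi_apply m).comp measurable_fst).snd).prodMk
      measurable_snd.snd
  exact (h.indep_attr n).comp measurable_id hψ

omit [IsProbabilityMeasure μ] in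
lemma measurable_past_list (n : ℕ) :
    Measurable fun ω => (past S W n ω, (⇑(S n ω) : Fin K → Fin L)) :=
  (h.measurable_past n).prodMk (h.measurable_coe_list n)

lemma measureReal_attr_eq (n : ℕ) (i : Fin L) (b : Bool) :
    μ.real {ω | W n ω i = b} = bernWeight (weight x β i) b := by
  cases b
  · have hm : MeasurableSet {ω | W n ω i = true} :=
      (measurable_pi_iff.1 (h.measurable_attr n) i) (measurableSet_singleton true)
    have : {ω | W n ω i = false} = {ω | W n ω i = true}ᶜ := by ext; simp
    rw [this, probReal_compl_eq_one_sub hm, h.law_attr]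
    simp [bernWeight]
  · rw [h.law_attr]
    simp [bernWeight]

/-- The items of a list are distinct, so their attractions are jointly independent. -/
lemma integral_attr_eq_cascadeMean (n : ℕ) (T : RecList K L) (φ : (Fin K → Bool) → ℝ) :
    ∫ z, φ (fun k => z (T k)) ∂(μ.map (W n)) = cascadeMean (fun k => weight x β (T k)) φ := by
  have hZ : Measurable fun ω => (fun k => W n ω (T k)) :=
    measurable_pi_iff.2 fun k => measurable_pi_iff.1 (h.measurable_attr n) (T k)
  have hφ : Measurable φ := Measurable.of_discrete
  have hφ' : Measurable fun z : Fin L → Bool => φ fun k => z (T k) := Measurable.of_discrete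
  rw [integral_map (h.measurable_attr n).aemeasurable hφ'.aestronglyMeasurable]
  have : IsProbabilityMeasure (μ.map fun ω => (fun k => W n ω (T k))) :=
    Measure.isProbabilityMeasure_map hZ.aemeasurable
  rw [← integral_map (φ := fun ω => (fun k => W n ω (T k))) hZ.aemeasurable
    hφ.aestronglyMeasurable, integral_fintype .of_finite]
  refine Finset.sum_congr rfl fun V _ => ?_
  rw [smul_eq_mul]
  congr 1
  rw [map_measureReal_apply hZ (measurableSet_singleton V)]
  have hset : (fun ω => (fun k => W n ω (T k))) ⁻¹' {V} =
      ⋂ k ∈ Finset.univ, (fun ω => W n ω (T k)) ⁻¹' {V k} := by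
    ext ω; simp [funext_iff]
  have hind := (h.indep_items n).precomp T.injective
  rw [hset, measureReal_def, hind.measure_inter_preimage_eq_mul Finset.univ
    (fun k _ => measurableSet_singleton (V k)), ENNReal.toReal_prod]
  exact Finset.prod_congr rfl fun k _ => h.measureReal_attr_eq n (T k) (V k)

/-- The conditional expectation of the feedback of a round, given the past and the list. -/
lemma integral_round (n : ℕ) {Φ : Ω → (Fin K → Bool) → ℝ}
    (hΦ : ∀ ω ω', (∀ m < n, S m ω = S m ω' ∧ W m ω = W m ω') → S n ω = S n ω' → Φ ω = Φ ω') :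
    ∫ ω, Φ ω (fun k => W n ω (S n ω k)) ∂μ =
      ∫ ω, cascadeMean (fun k => weight x β (S n ω k)) (Φ ω) ∂μ := by
  have : IsProbabilityMeasure (μ.map (W n)) :=
    Measure.isProbabilityMeasure_map (h.measurable_attr n).aemeasurable
  have := (integral_of_indepFun_finite (h.measurable_past_list n) (h.measurable_attr n)
    (h.indepFun_attr_past n) (f := fun ω z => Φ ω fun k => z (S n ω k)) (fun ω ω' hω => by
      simp only [Prod.mk.injEq] at hω
      have hS : S n ω = S n ω' := DFunLike.coe_injective hω.2
      rw [hΦ ω ω' (eq_of_past_eq hω.1) hS, hS]) (fun ω => Measurable.of_discrete)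
    (fun ω => .of_finite)).2
  rw [this]
  exact integral_congr_ae (ae_of_all _ fun ω => h.integral_attr_eq_cascadeMean n (S n ω) (Φ ω))

/-- The potential starts at exp 0 / det I = 1 and does not grow on average in any round. -/
lemma integral_devPotential_le_one (hw : ∀ i, weight x β i ∈ Set.Icc (0 : ℝ) 1) (n : ℕ) :
    ∫ ω, devPotential (gram x (fun m => S m ω) (fun m => W m ω) n)
      (noise x (fun m => S m ω) (fun m => W m ω) (weight x β) n) ∂μ ≤ 1 := by
  induction n with
  | zero => simp [gram, noise, devPotential, invForm]
  | succ n ih =>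
    refine le_trans ?_ ih
    have hr := h.integral_round n
      (Φ := fun ω V => devPotential (gram x (fun m => S m ω) (fun m => W m ω) n +
          ∑ k ∈ seen V, vecMulVec (x (S n ω k)).ofLp (x (S n ω k)).ofLp)
        (noise x (fun m => S m ω) (fun m => W m ω) (weight x β) n +
          ∑ k ∈ seen V, ((if V k = true then 1 else 0) - weight x β (S n ω k)) •
            (x (S n ω k)).ofLp)) (fun ω ω' h1 h2 => by
        simp only [gram_congr x _ _ h1, noise_congr x _ _ h1, h2])
    simp only [gram, noise, observed_eq_seen]
    rw [hr]
    refine integral_mono ?_ ?_ fun ω => cascadeMean_devPotential_le (fun k => hw (S n ω k))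
      (fun k => (x (S n ω k)).ofLp) (isDesign_gram x _ _ n).posDef _
    · refine integrable_of_factors (h.measurable_past_list n) fun ω ω' hω => ?_
      simp only [Prod.mk.injEq] at hω
      have hS : S n ω = S n ω' := DFunLike.coe_injective hω.2
      have hP := eq_of_past_eq hω.1
      simp only [gram_congr x _ _ hP, noise_congr x _ _ hP, hS]
    · refine integrable_of_factors (h.measurable_past n) fun ω ω' hω => ?_
      have hP := eq_of_past_eq hω
      simp only [gram_congr x _ _ hP, noise_congr x _ _ hP]

omit [IsProbabilityMeasure μ] in
lemma measurable_devPotential (n : ℕ) :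
    Measurable fun ω => devPotential (gram x (fun m => S m ω) (fun m => W m ω) n)
      (noise x (fun m => S m ω) (fun m => W m ω) (weight x β) n) :=
  measurable_of_factors (h.measurable_past n) fun ω ω' hω => by
    have hP := eq_of_past_eq hω
    simp only [gram_congr x _ _ hP, noise_congr x _ _ hP]

omit [IsProbabilityMeasure μ] in
lemma measurableSet_accurate (n : ℕ) : MeasurableSet (accurate x β S W n) :=
  measurableSet_le (h.measurable_devPotential n) measurable_const

/-- Markov's inequality at the threshold n + 1, chosen so that the failure probabilities sum to
O(log T). -/
lemma measureReal_compl_accurate_le (hw : ∀ i, weight x β i ∈ Set.Icc (0 : ℝ) 1) (n : ℕ) :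
    μ.real (accurate x β S W n)ᶜ ≤ 1 / ((n : ℝ) + 1) := by
  have hI : Integrable (fun ω => devPotential (gram x (fun m => S m ω) (fun m => W m ω) n)
      (noise x (fun m => S m ω) (fun m => W m ω) (weight x β) n)) μ :=
    integrable_of_factors (h.measurable_past n) fun ω ω' hω => by
      have hP := eq_of_past_eq hω
      simp only [gram_congr x _ _ hP, noise_congr x _ _ hP]
  have hM := mul_meas_ge_le_integral_of_nonneg (ae_of_all _ fun ω =>
    devPotential_nonneg (isDesign_gram x (fun m => S m ω) (fun m => W m ω) n).posDef
      (noise x (fun m => S m ω) (fun m => W m ω) (weight x β) n)) hI ((n : ℝ) + 1)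
  have hM' := hM.trans (h.integral_devPotential_le_one hw n)
  rw [le_div_iff₀ (by positivity), mul_comm]
  refine le_trans ?_ hM'
  refine mul_le_mul_of_nonneg_left (measureReal_mono fun ω hω => ?_) (by positivity)
  rw [Set.mem_compl_iff, accurate, Set.mem_ofPred_eq, not_le] at hω
  exact hω.le

/-- The expected squared widths of all lists shown sum up to `O(K d log T)`. -/
lemma sum_integral_listWidth_sq_le (hK : 1 ≤ K) (hx : ∀ i, ‖x i‖ ≤ 1 / √(K : ℝ))
    (hw : ∀ i, weight x β i ∈ Set.Icc (0 : ℝ) 1) (T : ℕ) :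
    ∑ n ∈ Finset.range T, ∫ ω, listWidth (weight x β)
      (fun i => Matrix.toEuclideanLin (invSqrt (gram x (fun m => S m ω) (fun m => W m ω) n)) (x i))
        (S n ω) ^ 2 ∂μ ≤ K * (2 * Real.exp 1 * (d * Real.log (T + 1))) := by
  have hfac : ∀ n, Integrable (fun ω => listWidth (weight x β) (fun i => Matrix.toEuclideanLin
      (invSqrt (gram x (fun m => S m ω) (fun m => W m ω) n)) (x i)) (S n ω) ^ 2) μ := fun n =>
    integrable_of_factors (h.measurable_past_list n) fun ω ω' hω => by
      simp only [Prod.mk.injEq] at hω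
      have hS : S n ω = S n ω' := DFunLike.coe_injective hω.2
      simp only [gram_congr x _ _ (eq_of_past_eq hω.1), hS]
  have hfac2 : ∀ n, Integrable (fun ω => ∑ k ∈ observed (S n ω) (W n ω),
      invForm (gram x (fun m => S m ω) (fun m => W m ω) n) (x (S n ω k)).ofLp
        (x (S n ω k)).ofLp) μ := fun n =>
    integrable_of_factors (h.measurable_past (n + 1)) fun ω ω' hω => by
      have hP := eq_of_past_eq hω
      have hn := hP n n.lt_succ_self
      simp only [gram_congr x _ _ fun m hm => hP m (Nat.lt_succ_of_lt hm), hn.1, hn.2]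
  have hfac3 : ∀ n, Integrable (fun ω => ∑ k, viewProb (fun k => weight x β (S n ω k)) k *
      invForm (gram x (fun m => S m ω) (fun m => W m ω) n) (x (S n ω k)).ofLp
        (x (S n ω k)).ofLp) μ := fun n =>
    integrable_of_factors (h.measurable_past_list n) fun ω ω' hω => by
      simp only [Prod.mk.injEq] at hω
      have hS : S n ω = S n ω' := DFunLike.coe_injective hω.2
      simp only [gram_congr x _ _ (eq_of_past_eq hω.1), hS]
  have hn : ∀ n, ∫ ω, listWidth (weight x β) (fun i => Matrix.toEuclideanLin
      (invSqrt (gram x (fun m => S m ω) (fun m => W m ω) n)) (x i)) (S n ω) ^ 2 ∂μ ≤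
      K * ∫ ω, ∑ k ∈ observed (S n ω) (W n ω),
        invForm (gram x (fun m => S m ω) (fun m => W m ω) n) (x (S n ω k)).ofLp
          (x (S n ω k)).ofLp ∂μ := by
    intro n
    have hr := h.integral_round n
      (Φ := fun ω V => ∑ k ∈ seen V, invForm (gram x (fun m => S m ω) (fun m => W m ω) n)
        (x (S n ω k)).ofLp (x (S n ω k)).ofLp) (fun ω ω' h1 h2 => by
        simp only [gram_congr x _ _ h1, h2])
    simp only [observed_eq_seen]
    -- Averaging the feedback turns the observed sum into the sum weighted by the probabilities of
    -- being seen.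
    rw [hr, ← integral_const_mul]
    simp only [cascadeMean_sum_seen]
    refine integral_mono (hfac n) ((hfac3 n).const_mul _) fun ω => ?_
    refine (listWidth_sq_le hw _ _).trans (le_of_eq ?_)
    simp only [norm_sq_toEuclideanLin_invSqrt (isDesign_gram x _ _ n).posDef]
  refine (Finset.sum_le_sum fun n _ => hn n).trans ?_
  rw [← Finset.mul_sum, ← integral_finsetSum _ fun n _ => hfac2 n]
  gcongr
  refine (integral_mono (integrable_finsetSum _ fun n _ => hfac2 n) (integrable_const _) fun ω =>
    sum_invForm_observed_le (fun m => S m ω) (fun m => W m ω) hK hx T).trans ?_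
  simp

end IsLinTSCascadeRun

/-! ### Regret of one round -/

/-- The ratio of the confidence radius to the scale of the Gaussian perturbation. -/
def radiusRatio (lam B : ℝ) : ℝ := (√2 + |B| / √(Real.log 2)) / (3 * lam)

lemma radiusRatio_nonneg {lam : ℝ} (hlam : 0 < lam) (B : ℝ) : 0 ≤ radiusRatio lam B := by
  unfold radiusRatio; positivity

/-- The norm bound B is absorbed using √(d l) ≥ √(log 2). The factor √K in the perturbation is only
used as being at least 1. -/
lemma radius_le {lam B b l : ℝ} (hlam : 0 < lam) (hb : b ≤ B) (hd : 1 ≤ d) (hK : 1 ≤ K)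
    (hl : Real.log 2 ≤ l) :
    √(2 * (d * l)) + b ≤ radiusRatio lam B * (lam * (3 * √(d * l)) * √K) := by
  have hl2 : 0 < √(Real.log 2) := Real.sqrt_pos.2 (Real.log_pos one_lt_two)
  have hd' : (1 : ℝ) ≤ d := by exact_mod_cast hd
  have hK' : 1 ≤ √(K : ℝ) := Real.one_le_sqrt.2 (by exact_mod_cast hK)
  have hl0 : 0 < l := (Real.log_pos one_lt_two).trans_le hl
  have h1 : √(Real.log 2) ≤ √(d * l) := Real.sqrt_le_sqrt (by nlinarith)
  have e : radiusRatio lam B * (lam * (3 * √(d * l)) * √K) =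
      (√2 * √(d * l) + |B| * (√(d * l) / √(Real.log 2))) * √K := by
    unfold radiusRatio; field_simp
  rw [e, Real.sqrt_mul (by norm_num) ((d : ℝ) * l)]
  have h2 : 1 ≤ √(d * l) / √(Real.log 2) := by rwa [le_div_iff₀ hl2, one_mul]
  have h3 : |B| ≤ |B| * (√(d * l) / √(Real.log 2)) := le_mul_of_one_le_right (abs_nonneg _) h2
  refine le_trans ?_ (le_mul_of_one_le_right (by positivity) hK')
  linarith [le_abs_self B]

/-- Symmetry of M^{-1/2} moves it onto the feature vector, so a perturbation has size proportional
to the width of its item. -/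
lemma inner_thompson (lam : ℝ) (x : Fin L → EuclideanSpace ℝ (Fin d))
    (β : EuclideanSpace ℝ (Fin d)) (S : ℕ → RecList K L) (W : ℕ → Fin L → Bool) (n : ℕ)
    (z : EuclideanSpace ℝ (Fin d)) :
    (fun i => inner ℝ (x i) (thompson lam x S W n z)) =
      noisyScore (weight x β) x (psiHat x S W n - β)
        (lam * (3 * √(d * Real.log ((n : ℝ) + 1))) * √K)
        (Matrix.toEuclideanLin (invSqrt (gram x S W n))) z := by
  funext i
  rw [noisyScore, weight, thompson, inner_add_right, inner_sub_right, real_inner_smul_right,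
    inner_toEuclideanLin_invSqrt]
  ring

namespace IsLinTSCascadeRun

variable {Ω : Type*} [MeasurableSpace Ω] {μ : Measure Ω} [IsProbabilityMeasure μ] {lam : ℝ}
  {x : Fin L → EuclideanSpace ℝ (Fin d)} {β : EuclideanSpace ℝ (Fin d)}
  {ξ : ℕ → Ω → EuclideanSpace ℝ (Fin d)} {S : ℕ → Ω → RecList K L}
  {W : ℕ → Ω → Fin L → Bool} (h : IsLinTSCascadeRun μ lam x β ξ S W)

include h

lemma integrable_regret (n : ℕ) :
    Integrable (fun ω => optReward K (weight x β) - reward (weight x β) (S n ω)) μ :=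
  integrable_of_factors (h.measurable_coe_list n) fun ω ω' hω => by
    rw [DFunLike.coe_injective hω]

/-- Second moment of the largest normalized Gaussian perturbation. -/
lemma integral_maxAbsInner_gauss_sq_le (hL : 2 ≤ L) (n : ℕ) :
    Integrable (fun ω => maxAbsInner (fun i => unitVec (Matrix.toEuclideanLin
      (invSqrt (gram x (fun m => S m ω) (fun m => W m ω) n)) (x i))) (ξ n ω)) μ ∧
    Integrable (fun ω => maxAbsInner (fun i => unitVec (Matrix.toEuclideanLin
      (invSqrt (gram x (fun m => S m ω) (fun m => W m ω) n)) (x i))) (ξ n ω) ^ 2) μ ∧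
    ∫ ω, maxAbsInner (fun i => unitVec (Matrix.toEuclideanLin
      (invSqrt (gram x (fun m => S m ω) (fun m => W m ω) n)) (x i))) (ξ n ω) ^ 2 ∂μ ≤
        7 * min (d : ℝ) (Real.log L) := by
  have hb : ∀ ω, _ := fun ω => integral_maxAbsInner_sq_le hL (y := fun i => unitVec
    (Matrix.toEuclideanLin (invSqrt (gram x (fun m => S m ω) (fun m => W m ω) n)) (x i)))
    fun i => norm_unitVec _
  have h1 := integral_of_indepFun_finite (h.measurable_past n) (h.measurable_gauss n)
    (h.indepFun_gauss_past n) (f := fun ω z => maxAbsInner (fun i => unitVec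
      (Matrix.toEuclideanLin (invSqrt (gram x (fun m => S m ω) (fun m => W m ω) n)) (x i))) z)
    (fun ω ω' hω => by simp only [gram_congr x _ _ (eq_of_past_eq hω)])
    (fun ω => measurable_maxAbsInner _) (fun ω => by
      rw [h.law_gauss]
      exact ((memLp_two_iff_integrable_sq (measurable_maxAbsInner _).aestronglyMeasurable).2
        (hb ω).1).integrable one_le_two)
  have h2 := integral_of_indepFun_finite (h.measurable_past n) (h.measurable_gauss n)
    (h.indepFun_gauss_past n) (f := fun ω z => maxAbsInner (fun i => unitVec
      (Matrix.toEuclideanLin (invSqrt (gram x (fun m => S m ω) (fun m => W m ω) n)) (x i))) z ^ 2)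
    (fun ω ω' hω => by simp only [gram_congr x _ _ (eq_of_past_eq hω)])
    (fun ω => (measurable_maxAbsInner _).pow_const 2) (fun ω => by
      rw [h.law_gauss]
      exact (hb ω).1)
  refine ⟨h1.1, h2.1, ?_⟩
  rw [h2.2, h.law_gauss]
  refine (integral_mono (integrable_of_factors (h.measurable_past n) fun ω ω' hω => by
    simp only [gram_congr x _ _ (eq_of_past_eq hω)]) (integrable_const _)
    fun ω => (hb ω).2).trans ?_
  simp

/-- The expected regret of one round, in terms of the width of the list shown. -/
lemma integral_regret_le (hlam : 0 < lam) {B : ℝ} (hd : 1 ≤ d) (hK : 1 ≤ K) (hL : 2 ≤ L)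
    (hx : ∀ i, ‖x i‖ ≤ 1 / √(K : ℝ)) (hw : ∀ i, weight x β i ∈ Set.Icc (0 : ℝ) 1)
    (hβ : ‖β‖ ≤ B) {c : ℝ} (hc0 : 0 < c)
    (hc : ∀ y : EuclideanSpace ℝ (Fin d), c ≤ (stdGaussian (EuclideanSpace ℝ (Fin d))).real
      {z | radiusRatio lam B * ‖y‖ ≤ inner ℝ y z}) {n : ℕ} (hn : 1 ≤ n) :
    ∫ ω, (optReward K (weight x β) - reward (weight x β) (S n ω)) ∂μ ≤ 1 / ((n : ℝ) + 1) +
      (1 + c⁻¹) * (lam * (3 * √(d * Real.log ((n : ℝ) + 1))) * √K) *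
        ∫ ω, listWidth (weight x β) (fun i => Matrix.toEuclideanLin
            (invSqrt (gram x (fun m => S m ω) (fun m => W m ω) n)) (x i)) (S n ω) *
          (2 * radiusRatio lam B + 1 + maxAbsInner (fun i => unitVec (Matrix.toEuclideanLin
            (invSqrt (gram x (fun m => S m ω) (fun m => W m ω) n)) (x i))) (ξ n ω)) ∂μ := by
  set w := weight x β with hw_def
  set G := radiusRatio lam B with hG_def
  set V := lam * (3 * √(d * Real.log ((n : ℝ) + 1))) * √K with hV_def
  set γ := stdGaussian (EuclideanSpace ℝ (Fin d))
  set Q : Ω → EuclideanSpace ℝ (Fin d) →ₗ[ℝ] EuclideanSpace ℝ (Fin d) := fun ω =>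
    Matrix.toEuclideanLin (invSqrt (gram x (fun m => S m ω) (fun m => W m ω) n)) with hQ
  set ε : Ω → EuclideanSpace ℝ (Fin d) := fun ω =>
    psiHat x (fun m => S m ω) (fun m => W m ω) n - β with hε_def
  have hG : 0 ≤ G := radiusRatio_nonneg hlam B
  have hV : 0 ≤ V := by positivity
  obtain ⟨ω₀⟩ : Nonempty Ω := nonempty_of_isProbabilityMeasure μ
  have hne : Nonempty (RecList K L) := ⟨S 0 ω₀⟩
  have hacc : ∀ ω ∈ accurate x β S W n, ∀ y, |inner ℝ y (ε ω)| ≤ G * V * ‖Q ω y‖ := by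
    intro ω hω y
    refine (abs_inner_psiHat_sub_le _ _ hd hx β y n hω).trans ?_
    gcongr
    -- From `n ≥ 1` the logarithm is at least log 2; at n = 0 the perturbation would vanish.
    refine radius_le hlam hβ hd hK (Real.log_le_log two_pos ?_)
    have : (1 : ℝ) ≤ n := by exact_mod_cast hn
    linarith
  have hpast : ∀ ω ω', past S W n ω = past S W n ω' → Q ω = Q ω' ∧ ε ω = ε ω' ∧
      (ω ∈ accurate x β S W n ↔ ω' ∈ accurate x β S W n) := by
    intro ω ω' hω
    have hP := eq_of_past_eq hω
    refine ⟨?_, ?_, mem_accurate_congr hP⟩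
    · simp only [hQ, gram_congr x _ _ hP]
    · simp only [hε_def, psiHat, gram_congr x _ _ hP, bvec_congr x _ _ hP]
  classical
  set χ : Ω → ℝ := (accurate x β S W n).indicator 1 with hχ_def
  have hχ : ∀ ω, χ ω = if ω ∈ accurate x β S W n then 1 else 0 := fun ω => by
    simp [hχ_def, Set.indicator_apply]
  have hχpast : ∀ ω ω', past S W n ω = past S W n ω' → χ ω = χ ω' := fun ω ω' hω => by
    rw [hχ, hχ]; simp only [(hpast ω ω' hω).2.2]
  have hχI : Integrable χ μ := integrable_of_factors (h.measurable_past n) hχpast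
  -- the optimistic value and its mean
  set F : Ω → EuclideanSpace ℝ (Fin d) → ℝ := fun ω z =>
    optReward K (clip (noisyScore w x (ε ω) V (Q ω) z)) with hF
  set m : Ω → ℝ := fun ω => ∫ z, F ω z ∂γ with hm_def
  have hFm : ∀ ω, Measurable (F ω) := fun ω => measurable_optReward_clip_noisyScore
  have hF01 : ∀ ω z, F ω z ∈ Set.Icc (0 : ℝ) 1 := fun ω z => optReward_mem (clip_mem _)
  have hFI : ∀ ω, Integrable (F ω) γ := fun ω =>
    integrable_of_mem_Icc (hFm ω).aestronglyMeasurable (hF01 ω)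
  have hFpast : ∀ ω ω', past S W n ω = past S W n ω' → F ω = F ω' := fun ω ω' hω => by
    simp only [hF, (hpast ω ω' hω).1, (hpast ω ω' hω).2.1]
  have hmpast : ∀ ω ω', past S W n ω = past S W n ω' → m ω = m ω' := fun ω ω' hω => by
    simp only [hm_def, hFpast ω ω' hω]
  set r := optReward K w
  set A : Ω → ℝ := fun ω => listWidth w (fun i => Q ω (x i)) (S n ω) with hA_def
  set Z : Ω → ℝ := fun ω => maxAbsInner (fun i => unitVec (Q ω (x i))) (ξ n ω) with hZ_def
  have hA0 : ∀ ω, 0 ≤ A ω := fun ω => listWidth_nonneg hw _ _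
  have hZ0 : ∀ ω, 0 ≤ Z ω := fun ω => maxAbsInner_nonneg _ _
  have hApast : ∀ ω ω', (past S W n ω, (⇑(S n ω) : Fin K → Fin L)) =
      (past S W n ω', ⇑(S n ω')) → A ω = A ω' := fun ω ω' hω => by
    simp only [Prod.mk.injEq] at hω
    have hS : S n ω = S n ω' := DFunLike.coe_injective hω.2
    simp only [hA_def, (hpast ω ω' hω.1).1, hS]
  have hZI : Integrable Z μ := (h.integral_maxAbsInner_gauss_sq_le hL n).1
  obtain ⟨C, hC⟩ := exists_bound_of_factors hApast
  have hAZI : Integrable (fun ω => A ω * (2 * G + 1 + Z ω)) μ :=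
    ((integrable_const _).add hZI).bdd_mul
      (measurable_of_factors (h.measurable_past_list n) hApast).aestronglyMeasurable
      (ae_of_all _ hC)
  -- averaging over the Gaussian vector of the round
  have e1 := integral_of_indepFun_finite (h.measurable_past n) (h.measurable_gauss n)
    (h.indepFun_gauss_past n) (f := fun ω z => χ ω * (r - F ω z))
    (fun ω ω' hω => by simp only [hχpast ω ω' hω, hFpast ω ω' hω])
    (fun ω => ((hFm ω).const_sub r).const_mul _)
    (fun ω => by rw [h.law_gauss]; exact ((integrable_const r).sub (hFI ω)).const_mul _)
  have hposI : ∀ ω, Integrable (fun z => max (F ω z - m ω) 0) γ := fun ω =>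
    ((hFI ω).sub (integrable_const _)).pos_part
  have e2 := integral_of_indepFun_finite (h.measurable_past n) (h.measurable_gauss n)
    (h.indepFun_gauss_past n) (f := fun ω z => χ ω * max (F ω z - m ω) 0)
    (fun ω ω' hω => by simp only [hχpast ω ω' hω, hFpast ω ω' hω, hmpast ω ω' hω])
    (fun ω => (((hFm ω).sub_const _).max measurable_const).const_mul _)
    (fun ω => by rw [h.law_gauss]; exact (hposI ω).const_mul _)
  rw [h.law_gauss] at e1 e2
  have hgreedy : ∀ᵐ ω ∂μ, IsGreedy (noisyScore w x (ε ω) V (Q ω) (ξ n ω)) (S n ω) := by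
    filter_upwards [h.greedy n] with ω hω
    rwa [inner_thompson lam x β] at hω
  -- Optimism bounds the mean shortfall by the mean fluctuation over a fresh Gaussian. Independence
  -- identifies this with a fluctuation at `ξ n` itself, whose greedy list is the one shown.
  have b1 : ∫ ω, χ ω * (r - F ω (ξ n ω)) ∂μ ≤
      c⁻¹ * (V * ∫ ω, A ω * (2 * G + 1 + Z ω) ∂μ) := by
    calc _ = ∫ ω, ∫ z, χ ω * (r - F ω z) ∂γ ∂μ := e1.2
      _ ≤ ∫ ω, c⁻¹ * ∫ z, χ ω * max (F ω z - m ω) 0 ∂γ ∂μ := by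
          refine integral_mono
            (integrable_of_factors (h.measurable_past n) fun ω ω' hω => by
              simp only [hχpast ω ω' hω, hFpast ω ω' hω])
            (integrable_of_factors (h.measurable_past n) fun ω ω' hω => by
              simp only [hχpast ω ω' hω, hFpast ω ω' hω, hmpast ω ω' hω]) fun ω => ?_
          simp only [integral_const_mul]
          rw [hχ]
          split_ifs with hω
          · rw [one_mul, one_mul, integral_sub (integrable_const _) (hFI ω), integral_const,
              probReal_univ, one_smul]
            exact optReward_sub_integral_le hw hV (hacc ω hω) hc0 hc (m ω)
          · simp
      _ = c⁻¹ * ∫ ω, χ ω * max (F ω (ξ n ω) - m ω) 0 ∂μ := by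
          rw [integral_const_mul, e2.2]
      _ ≤ c⁻¹ * ∫ ω, V * (A ω * (2 * G + 1 + Z ω)) ∂μ := by
          refine mul_le_mul_of_nonneg_left
            (integral_mono_ae e2.1 (hAZI.const_mul V) ?_) (inv_nonneg.2 hc0.le)
          filter_upwards [hgreedy] with ω hω
          rw [hχ]
          split_ifs with ha
          · rw [one_mul, ← mul_assoc]
            exact optReward_clip_sub_integral_le hw hV (hacc ω ha) hG hω
          · rw [zero_mul]
            have := hA0 ω
            have := hZ0 ω
            positivity
      _ = _ := by rw [integral_const_mul]
  -- Where the estimate is inaccurate the regret is at most 1, which is the term `1 - χ ω`.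
  have b2 : ∀ᵐ ω ∂μ, r - reward w (S n ω) ≤
      (1 - χ ω) + χ ω * (r - F ω (ξ n ω)) + V * (A ω * (2 * G + 1 + Z ω)) := by
    filter_upwards [hgreedy] with ω hω
    have hA := hA0 ω
    have hZ := hZ0 ω
    rw [hχ]
    split_ifs with ha
    · have h1 : F ω (ξ n ω) = reward (clip (noisyScore w x (ε ω) V (Q ω) (ξ n ω))) (S n ω) :=
        hω.optReward_clip_eq
      have h2 := (le_abs_self _).trans
        (reward_clip_sub_reward_le (x := x) hw hV (hacc ω ha) (ξ n ω) (S n ω))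
      rw [h1]
      have h3 : V * A ω * (G + Z ω) ≤ V * (A ω * (2 * G + 1 + Z ω)) := by
        rw [mul_assoc]; gcongr; linarith
      linarith
    · have h1 : r ≤ 1 := (optReward_mem hw).2
      have h2 := (reward_mem hw (S n ω)).1
      have : 0 ≤ V * (A ω * (2 * G + 1 + Z ω)) := by positivity
      linarith
  have b3 : ∫ ω, (1 - χ ω) ∂μ ≤ 1 / ((n : ℝ) + 1) := by
    rw [integral_sub (integrable_const _) hχI, hχ_def, integral_indicator_one
      (h.measurableSet_accurate n), integral_const, probReal_univ, one_smul,
      ← probReal_compl_eq_one_sub (h.measurableSet_accurate n)]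
    exact h.measureReal_compl_accurate_le hw n
  have hI1 : Integrable (fun ω => 1 - χ ω) μ := (integrable_const _).sub hχI
  calc _ ≤ ∫ ω, ((1 - χ ω) + χ ω * (r - F ω (ξ n ω)) + V * (A ω * (2 * G + 1 + Z ω))) ∂μ :=
        integral_mono_ae (h.integrable_regret n) ((hI1.add e1.1).add (hAZI.const_mul V)) b2
    _ = ∫ ω, (1 - χ ω) ∂μ + ∫ ω, χ ω * (r - F ω (ξ n ω)) ∂μ +
        V * ∫ ω, A ω * (2 * G + 1 + Z ω) ∂μ := by
        have hI2 : Integrable (fun ω => 1 - χ ω + χ ω * (r - F ω (ξ n ω))) μ := hI1.add e1.1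
        rw [integral_add hI2 (hAZI.const_mul V), integral_add hI1 e1.1,
          integral_const_mul]
    _ ≤ 1 / ((n : ℝ) + 1) + c⁻¹ * (V * ∫ ω, A ω * (2 * G + 1 + Z ω) ∂μ) +
        V * ∫ ω, A ω * (2 * G + 1 + Z ω) ∂μ := by gcongr
    _ = _ := by ring

end IsLinTSCascadeRun

/-! ### Summation over rounds -/

lemma expRegret_eq_zero {Ω : Type*} [MeasurableSpace Ω] (μ : Measure Ω) [IsProbabilityMeasure μ]
    {w : Fin L → ℝ} (S : ℕ → Ω → RecList K L)
    (hw : ∀ S S' : RecList K L, reward w S = reward w S') (T : ℕ) : expRegret μ w S T = 0 := by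
  unfold expRegret
  refine integral_eq_zero_of_ae (ae_of_all _ fun ω => Finset.sum_eq_zero fun n _ => ?_)
  have : Nonempty (RecList K L) := ⟨S n ω⟩
  obtain ⟨S', hS'⟩ := exists_reward_eq_optReward (K := K) w
  rw [← hS', hw S' (S n ω), sub_self]

lemma sum_one_div_le (T : ℕ) :
    ∑ n ∈ Finset.range T, 1 / ((n : ℝ) + 1) ≤ 1 + Real.log T := by
  have := harmonic_le_one_add_log T
  refine le_trans (le_of_eq ?_) this
  simp [harmonic]

namespace IsLinTSCascadeRun

variable {Ω : Type*} [MeasurableSpace Ω] {μ : Measure Ω} [IsProbabilityMeasure μ] {lam : ℝ}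
  {x : Fin L → EuclideanSpace ℝ (Fin d)} {β : EuclideanSpace ℝ (Fin d)}
  {ξ : ℕ → Ω → EuclideanSpace ℝ (Fin d)} {S : ℕ → Ω → RecList K L}
  {W : ℕ → Ω → Fin L → Bool} (h : IsLinTSCascadeRun μ lam x β ξ S W)

include h

/-- Cauchy–Schwarz over the rounds for widths times perturbation sizes, in weighted form. -/
lemma sum_integral_listWidth_mul_le (hK : 1 ≤ K) (hL : 2 ≤ L)
    (hx : ∀ i, ‖x i‖ ≤ 1 / √(K : ℝ)) (hw : ∀ i, weight x β i ∈ Set.Icc (0 : ℝ) 1) (g : ℝ)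
    (T : ℕ) {θ : ℝ} (hθ : 0 < θ) :
    ∑ n ∈ Finset.range T, ∫ ω, listWidth (weight x β) (fun i => Matrix.toEuclideanLin
        (invSqrt (gram x (fun m => S m ω) (fun m => W m ω) n)) (x i)) (S n ω) *
      (g + maxAbsInner (fun i => unitVec (Matrix.toEuclideanLin
        (invSqrt (gram x (fun m => S m ω) (fun m => W m ω) n)) (x i))) (ξ n ω)) ∂μ ≤
      (θ * (K * (2 * Real.exp 1 * (d * Real.log (T + 1)))) +
        T * (2 * g ^ 2 + 14 * min (d : ℝ) (Real.log L)) / θ) / 2 := by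
  have hn : ∀ n, ∫ ω, listWidth (weight x β) (fun i => Matrix.toEuclideanLin
        (invSqrt (gram x (fun m => S m ω) (fun m => W m ω) n)) (x i)) (S n ω) *
      (g + maxAbsInner (fun i => unitVec (Matrix.toEuclideanLin
        (invSqrt (gram x (fun m => S m ω) (fun m => W m ω) n)) (x i))) (ξ n ω)) ∂μ ≤
      θ / 2 * ∫ ω, listWidth (weight x β) (fun i => Matrix.toEuclideanLin
        (invSqrt (gram x (fun m => S m ω) (fun m => W m ω) n)) (x i)) (S n ω) ^ 2 ∂μ +
      (2 * g ^ 2 + 14 * min (d : ℝ) (Real.log L)) / (2 * θ) := by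
    intro n
    obtain ⟨hZ, hZ2, hZle⟩ := h.integral_maxAbsInner_gauss_sq_le hL n
    have hApast : ∀ ω ω', (past S W n ω, (⇑(S n ω) : Fin K → Fin L)) =
        (past S W n ω', ⇑(S n ω')) → listWidth (weight x β) (fun i => Matrix.toEuclideanLin
        (invSqrt (gram x (fun m => S m ω) (fun m => W m ω) n)) (x i)) (S n ω) =
        listWidth (weight x β) (fun i => Matrix.toEuclideanLin
        (invSqrt (gram x (fun m => S m ω') (fun m => W m ω') n)) (x i)) (S n ω') := by
      intro ω ω' hω
      simp only [Prod.mk.injEq] at hω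
      have hS : S n ω = S n ω' := DFunLike.coe_injective hω.2
      simp only [gram_congr x _ _ (eq_of_past_eq hω.1), hS]
    set A : Ω → ℝ := fun ω => listWidth (weight x β) (fun i => Matrix.toEuclideanLin
        (invSqrt (gram x (fun m => S m ω) (fun m => W m ω) n)) (x i)) (S n ω)
    set Z : Ω → ℝ := fun ω => maxAbsInner (fun i => unitVec (Matrix.toEuclideanLin
        (invSqrt (gram x (fun m => S m ω) (fun m => W m ω) n)) (x i))) (ξ n ω)
    have hZ2 : Integrable (fun ω => Z ω ^ 2) μ := hZ2
    have hZle : ∫ ω, Z ω ^ 2 ∂μ ≤ 7 * min (d : ℝ) (Real.log L) := hZle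
    obtain ⟨C, hC⟩ := exists_bound_of_factors hApast
    have hAZI : Integrable (fun ω => A ω * (g + Z ω)) μ :=
      ((integrable_const _).add hZ).bdd_mul
        (measurable_of_factors (h.measurable_past_list n) hApast).aestronglyMeasurable
        (ae_of_all _ hC)
    have hA2 : Integrable (fun ω => A ω ^ 2) μ :=
      integrable_of_factors (h.measurable_past_list n) fun ω ω' hω => by
        exact congrArg (· ^ 2) (hApast ω ω' hω)
    have hI1 := hA2.const_mul (θ / 2)
    have hI2 : Integrable (fun ω => (2 * g ^ 2 + 2 * Z ω ^ 2) / (2 * θ)) μ :=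
      ((integrable_const _).add (hZ2.const_mul 2)).div_const _
    calc _ ≤ ∫ ω, (θ / 2 * A ω ^ 2 + (2 * g ^ 2 + 2 * Z ω ^ 2) / (2 * θ)) ∂μ := by
          refine integral_mono hAZI (hI1.add hI2) fun ω => ?_
          change A ω * (g + Z ω) ≤ θ / 2 * A ω ^ 2 + (2 * g ^ 2 + 2 * Z ω ^ 2) / (2 * θ)
          have e1 : (g + Z ω) ^ 2 / (2 * θ) ≤ (2 * g ^ 2 + 2 * Z ω ^ 2) / (2 * θ) := by
            gcongr
            nlinarith [sq_nonneg (g - Z ω)]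
          -- Completing the square; a single θ serves all rounds and is optimized only after
          -- summation.
          have e2 : θ / 2 * A ω ^ 2 + (g + Z ω) ^ 2 / (2 * θ) - A ω * (g + Z ω) =
              (θ * A ω - (g + Z ω)) ^ 2 / (2 * θ) := by field_simp; ring
          have e3 : 0 ≤ (θ * A ω - (g + Z ω)) ^ 2 / (2 * θ) := by positivity
          linarith
      _ = θ / 2 * ∫ ω, A ω ^ 2 ∂μ + (2 * g ^ 2 + 2 * ∫ ω, Z ω ^ 2 ∂μ) / (2 * θ) := by
          rw [integral_add hI1 hI2, integral_const_mul, integral_div,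
            integral_add (integrable_const _) (hZ2.const_mul 2), integral_const,
            probReal_univ, one_smul, integral_const_mul]
      _ ≤ _ := add_le_add le_rfl
          (div_le_div_of_nonneg_right (by linarith) (by positivity))
  refine (Finset.sum_le_sum fun n _ => hn n).trans ?_
  rw [Finset.sum_add_distrib, ← Finset.mul_sum, Finset.sum_const, Finset.card_range, nsmul_eq_mul]
  have h1 := mul_le_mul_of_nonneg_left (h.sum_integral_listWidth_sq_le hK hx hw T)
    (by positivity : 0 ≤ θ / 2)
  refine (add_le_add_left h1 _).trans (le_of_eq ?_)
  field_simp

/-- The regret bound before the constants are collected. -/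
lemma expRegret_le (hlam : 0 < lam) {B : ℝ} (hd : 1 ≤ d) (hK : 1 ≤ K) (hL : 2 ≤ L)
    (hx : ∀ i, ‖x i‖ ≤ 1 / √(K : ℝ)) (hw : ∀ i, weight x β i ∈ Set.Icc (0 : ℝ) 1)
    (hβ : ‖β‖ ≤ B) {c : ℝ} (hc0 : 0 < c)
    (hc : ∀ y : EuclideanSpace ℝ (Fin d), c ≤ (stdGaussian (EuclideanSpace ℝ (Fin d))).real
      {z | radiusRatio lam B * ‖y‖ ≤ inner ℝ y z}) (T : ℕ) {θ : ℝ} (hθ : 0 < θ) :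
    expRegret μ (weight x β) S T ≤ 1 + Real.log T +
      (1 + c⁻¹) * (lam * (3 * √(d * Real.log T)) * √K) *
        ((θ * (K * (2 * Real.exp 1 * (d * Real.log (T + 1)))) +
          T * (2 * (2 * radiusRatio lam B + 1) ^ 2 + 14 * min (d : ℝ) (Real.log L)) / θ) / 2) := by
  unfold expRegret
  rw [integral_finsetSum _ fun n _ => h.integrable_regret n]
  have hG := radiusRatio_nonneg hlam B
  have hI0 : ∀ n, 0 ≤ ∫ ω, listWidth (weight x β) (fun i => Matrix.toEuclideanLin
        (invSqrt (gram x (fun m => S m ω) (fun m => W m ω) n)) (x i)) (S n ω) *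
      (2 * radiusRatio lam B + 1 + maxAbsInner (fun i => unitVec (Matrix.toEuclideanLin
        (invSqrt (gram x (fun m => S m ω) (fun m => W m ω) n)) (x i))) (ξ n ω)) ∂μ := fun n =>
    integral_nonneg fun ω => mul_nonneg (listWidth_nonneg hw _ _)
      (add_nonneg (by linarith) (maxAbsInner_nonneg _ _))
  have hn : ∀ n ∈ Finset.range T,
      ∫ ω, (optReward K (weight x β) - reward (weight x β) (S n ω)) ∂μ ≤ 1 / ((n : ℝ) + 1) +
      (1 + c⁻¹) * (lam * (3 * √(d * Real.log T)) * √K) *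
        ∫ ω, listWidth (weight x β) (fun i => Matrix.toEuclideanLin
            (invSqrt (gram x (fun m => S m ω) (fun m => W m ω) n)) (x i)) (S n ω) *
          (2 * radiusRatio lam B + 1 + maxAbsInner (fun i => unitVec (Matrix.toEuclideanLin
            (invSqrt (gram x (fun m => S m ω) (fun m => W m ω) n)) (x i))) (ξ n ω)) ∂μ := by
    intro n hnT
    -- In round 0 the trivial bound 1 is exactly the term 1/(n+1).
    rcases Nat.eq_zero_or_pos n with rfl | hn1
    · obtain ⟨ω₀⟩ : Nonempty Ω := nonempty_of_isProbabilityMeasure μ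
      have hne : Nonempty (RecList K L) := ⟨S 0 ω₀⟩
      have h1 : ∫ ω, (optReward K (weight x β) - reward (weight x β) (S 0 ω)) ∂μ ≤ 1 := by
        refine (integral_mono (h.integrable_regret 0) (integrable_const (1 : ℝ)) fun ω => ?_).trans
          (by simp)
        linarith [(optReward_mem (K := K) hw).2, (reward_mem hw (S 0 ω)).1]
      have h2 := mul_nonneg (by positivity : 0 ≤ (1 + c⁻¹) *
        (lam * (3 * √(d * Real.log T)) * √K)) (hI0 0)
      have h3 : 1 / (((0 : ℕ) : ℝ) + 1) = 1 := by simp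
      rw [h3]
      linarith
    · refine (h.integral_regret_le hlam hd hK hL hx hw hβ hc0 hc hn1).trans ?_
      have hnT' : (n : ℝ) + 1 ≤ T := by exact_mod_cast Finset.mem_range.1 hnT
      have hl : Real.log ((n : ℝ) + 1) ≤ Real.log T := Real.log_le_log (by positivity) hnT'
      have := hI0 n
      gcongr
  refine (Finset.sum_le_sum hn).trans ?_
  rw [Finset.sum_add_distrib, ← Finset.mul_sum]
  refine add_le_add (sum_one_div_le T) (mul_le_mul_of_nonneg_left ?_ (by positivity))
  exact h.sum_integral_listWidth_mul_le hK hL hx hw _ T hθ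

end IsLinTSCascadeRun

/-- The minimizer √(b/a) makes both terms equal and recovers the product form of Cauchy–Schwarz. -/
lemma exists_weighted_sum_eq_sqrt {a b : ℝ} (ha : 0 < a) (hb : 0 < b) :
    ∃ θ : ℝ, 0 < θ ∧ (θ * a + b / θ) / 2 = √a * √b := by
  have ha' := Real.sqrt_pos.2 ha
  have hb' := Real.sqrt_pos.2 hb
  refine ⟨√b / √a, div_pos hb' ha', ?_⟩
  have h1 : √b / √a * a = √a * √b := by
    nth_rewrite 2 [← Real.mul_self_sqrt ha.le]; field_simp
  have h2 : b / (√b / √a) = √a * √b := by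
    nth_rewrite 1 [← Real.mul_self_sqrt hb.le]; field_simp
  rw [h1, h2]; ring

/-- Collecting the constants of the regret bound. -/
lemma collect_constants {lam c g D k t m : ℝ} (hlam : 0 < lam) (hc0 : 0 < c) (hD : 1 ≤ D)
    (hk : 1 ≤ k) (ht : 2 ≤ t) (hm : √(Real.log 2) ≤ m) {a b : ℝ}
    (ha : a ≤ k * (2 * Real.exp 1 * (D * (2 * Real.log t))))
    (hb : b ≤ t * ((4 * g ^ 2 + 14) * m ^ 2)) :
    1 + Real.log t + (1 + c⁻¹) * (lam * (3 * √(D * Real.log t)) * √k) * (√a * √b) ≤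
      ((1 / Real.log 2 + 1) / Real.log 2 +
        (1 + c⁻¹) * (3 * lam) * √(4 * Real.exp 1) * √(4 * g ^ 2 + 14) / √(Real.log 2)) *
      (m * k * D * √t * Real.log t ^ (3 / 2 : ℝ)) := by
  have hl2 : 0 < Real.log 2 := Real.log_pos one_lt_two
  have hs2 : 0 < √(Real.log 2) := Real.sqrt_pos.2 hl2
  have hl : Real.log 2 ≤ Real.log t := Real.log_le_log two_pos ht
  have hl0 : 0 < Real.log t := hl2.trans_le hl
  have hm0 : 0 < m := hs2.trans_le hm
  have hpow : Real.log t ^ (3 / 2 : ℝ) = Real.log t * √(Real.log t) := by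
    rw [Real.sqrt_eq_rpow, ← Real.rpow_one_add' hl0.le (by norm_num)]
    norm_num
  have hsl : √(Real.log 2) ≤ √(Real.log t) := Real.sqrt_le_sqrt hl
  have hst : 1 ≤ √t := Real.one_le_sqrt.2 (by linarith)
  rw [hpow, add_mul ((1 / Real.log 2 + 1) / Real.log 2)]
  refine add_le_add ?_ ?_
  · have h1 : 1 ≤ Real.log t / Real.log 2 := by rwa [le_div_iff₀ hl2, one_mul]
    have h2 : Real.log 2 ≤ m * √(Real.log t) := by
      rw [← Real.mul_self_sqrt hl2.le]; gcongr
    have h3 : 1 ≤ k * D * √t := by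
      have : 1 ≤ k * D := one_le_mul_of_one_le_of_one_le hk hD
      exact one_le_mul_of_one_le_of_one_le this hst
    calc 1 + Real.log t ≤ Real.log t / Real.log 2 + Real.log t := by linarith
      _ = (1 / Real.log 2 + 1) / Real.log 2 * (Real.log 2 * 1 * Real.log t) := by field_simp
      _ ≤ (1 / Real.log 2 + 1) / Real.log 2 * (m * √(Real.log t) * (k * D * √t) * Real.log t) := by
          gcongr
      _ = _ := by ring
  · have h1 : √a ≤ √k * (√(4 * Real.exp 1) * (√D * √(Real.log t))) := by
      rw [← Real.sqrt_mul (by linarith), ← Real.sqrt_mul (by positivity),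
        ← Real.sqrt_mul (by linarith)]
      refine Real.sqrt_le_sqrt (ha.trans (le_of_eq ?_))
      ring
    have h2 : √b ≤ √t * (√(4 * g ^ 2 + 14) * m) := by
      refine (Real.sqrt_le_sqrt hb).trans (le_of_eq ?_)
      rw [Real.sqrt_mul (by linarith), Real.sqrt_mul (by positivity), Real.sqrt_sq hm0.le]
    -- The perturbation scale and the total width give only one full power of log t; the remaining
    -- half power is slack.
    have h3 : 1 ≤ √(Real.log t) / √(Real.log 2) := by rwa [le_div_iff₀ hs2, one_mul]
    calc _ ≤ (1 + c⁻¹) * (lam * (3 * √(D * Real.log t)) * √k) *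
          (√k * (√(4 * Real.exp 1) * (√D * √(Real.log t))) *
            (√t * (√(4 * g ^ 2 + 14) * m))) := by gcongr
      _ = (1 + c⁻¹) * (3 * lam) * √(4 * Real.exp 1) * √(4 * g ^ 2 + 14) *
          (m * (√k * √k) * (√D * √D) * √t * (√(Real.log t) * √(Real.log t))) * 1 := by
          rw [Real.sqrt_mul (by linarith)]; ring
      _ ≤ (1 + c⁻¹) * (3 * lam) * √(4 * Real.exp 1) * √(4 * g ^ 2 + 14) *
          (m * (√k * √k) * (√D * √D) * √t * (√(Real.log t) * √(Real.log t))) *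
            (√(Real.log t) / √(Real.log 2)) := by gcongr
      _ = _ := by
          rw [Real.mul_self_sqrt (by linarith), Real.mul_self_sqrt (by linarith),
            Real.mul_self_sqrt hl0.le]
          ring

end

end CascadingBandit

/-! ### Degenerate cases and conclusion -/

theorem theorem3 (lam : ℝ) (hlam : 0 < lam) (B : ℝ) :
    ∃ C : ℝ, ∀ (d L K : ℕ), 1 ≤ K → K ≤ L →
      ∀ (x : Fin L → EuclideanSpace ℝ (Fin d)) (β : EuclideanSpace ℝ (Fin d)),
      (∀ i, ‖x i‖ ≤ 1 / √(K : ℝ)) →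
      (∀ i, CascadingBandit.weight x β i ∈ Set.Icc (0 : ℝ) 1) →
      ‖β‖ ≤ B →
      ∀ (Ω : Type*) [MeasurableSpace Ω] (μ : MeasureTheory.Measure Ω)
        [MeasureTheory.IsProbabilityMeasure μ]
        (ξ : ℕ → Ω → EuclideanSpace ℝ (Fin d)) (S : ℕ → Ω → CascadingBandit.RecList K L)
        (W : ℕ → Ω → Fin L → Bool),
      CascadingBandit.IsLinTSCascadeRun μ lam x β ξ S W →
      ∀ T : ℕ, 2 ≤ T →
        CascadingBandit.expRegret μ (CascadingBandit.weight x β) S T ≤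
          C * (min (√(d : ℝ)) (√(Real.log L)) * K * d * √(T : ℝ) *
            Real.log T ^ (3 / 2 : ℝ)) := by
  open CascadingBandit in
  obtain ⟨c, hc0, hc⟩ := exists_pos_le_stdGaussian_real (radiusRatio lam B)
  refine ⟨(1 / Real.log 2 + 1) / Real.log 2 + (1 + c⁻¹) * (3 * lam) * √(4 * Real.exp 1) *
    √(4 * (2 * radiusRatio lam B + 1) ^ 2 + 14) / √(Real.log 2), ?_⟩
  intro d L K hK hKL x β hx hw hβ Ω _ μ _ ξ S W h T hT
  -- For d = 0 or L = 1 the right-hand side is 0, but all lists then have the same reward and the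
  -- regret vanishes too.
  rcases Nat.eq_zero_or_pos d with rfl | hd
  · have hw0 : ∀ i, weight x β i = 0 := fun i => by
      rw [weight, Subsingleton.elim β 0, inner_zero_right]
    rw [expRegret_eq_zero μ S (fun S S' => by simp [reward, hw0])]
    simp
  rcases Nat.lt_or_ge L 2 with hL | hL
  · obtain rfl : L = 1 := by omega
    rw [expRegret_eq_zero μ S fun S S' => by
      rw [show S = S' from DFunLike.ext _ _ fun k => Subsingleton.elim _ _]]
    simp
  have hl2 : 0 < Real.log 2 := Real.log_pos one_lt_two
  have hd' : (1 : ℝ) ≤ d := by exact_mod_cast hd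
  have hK' : (1 : ℝ) ≤ K := by exact_mod_cast hK
  have hT' : (2 : ℝ) ≤ T := by exact_mod_cast hT
  have hlL : Real.log 2 ≤ Real.log L := Real.log_le_log two_pos (by exact_mod_cast hL)
  have hlT : 0 < Real.log (T + 1 : ℝ) := Real.log_pos (by linarith)
  have hmin : √(Real.log 2) ≤ min (√(d : ℝ)) (√(Real.log L)) :=
    le_min (Real.sqrt_le_sqrt (by linarith [Real.log_two_lt_d9])) (Real.sqrt_le_sqrt hlL)
  have hmin_sq : min (√(d : ℝ)) (√(Real.log L)) ^ 2 = min (d : ℝ) (Real.log L) := by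
    rw [← Real.sqrt_monotone.map_min,
      Real.sq_sqrt (le_min (by linarith) (by linarith))]
  -- This turns the constant 2g² into 4g² times the minimum, as `collect_constants` requires.
  have hmin_half : 1 / 2 ≤ min (d : ℝ) (Real.log L) :=
    le_min (by linarith) (by linarith [Real.log_two_gt_d9])
  have hlT2 : Real.log (T + 1 : ℝ) ≤ 2 * Real.log T := by
    rw [show 2 * Real.log T = Real.log ((T : ℝ) ^ 2) by rw [Real.log_pow]; norm_num]
    exact Real.log_le_log (by linarith) (by nlinarith)
  set a : ℝ := K * (2 * Real.exp 1 * (d * Real.log (T + 1))) with ha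
  set b : ℝ := T * (2 * (2 * radiusRatio lam B + 1) ^ 2 + 14 * min (d : ℝ) (Real.log L)) with hb
  have ha0 : 0 < a := by positivity
  have hb0 : 0 < b := by positivity
  obtain ⟨θ, hθ, hθ_eq⟩ := exists_weighted_sum_eq_sqrt ha0 hb0
  have hmain := h.expRegret_le hlam hd hK hL hx hw hβ hc0 (hc d) T hθ
  rw [← ha, ← hb, hθ_eq] at hmain
  refine hmain.trans (collect_constants hlam hc0 hd' hK' hT' hmin ?_ ?_)
  · rw [ha]; gcongr
  · rw [hb, hmin_sq]
    gcongr
    nlinarith [sq_nonneg (2 * radiusRatio lam B + 1)]
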